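/- **Theorem (Sufficient conditions for full capacity).** For a finite compactly supported Borel measure $\mu$ on $\mathbb{C}$ let $I(\mu)=\iint(-\log|z-w|)\,d\mu(z)\,d\mu(w)\in(-\infty,+\infty]$, and for $E\subset\mathbb{C}$ let $\mathrm{Cap}(E)=\exp(-\inf I(\mu))$, where the infimum is taken over all Borel probability measures $\mu$ whose support is a compact subset of $E$ (with $e^{-\infty}=0$). Fix $\lambda>0$ and, for $k\in\mathbb{N}$, let $I_k$ be the open interval with center $c_k\in(0,1)$ and length $l_k=e^{-\lambda k}$. Put $\mathcal{A}_n=\{n,\dots,2n-1\}$ and $\mathcal{A}_{n,q}=\mathcal{A}_n\cup\mathcal{A}_{2n}\cup\dots\cup\mathcal{A}_{2^qn}$. Assume: - **A.1 (distribution)** there is $\phi\in L^1([0,1],dx)$ with $\phi>0$ a.e. such that for every $f\in C([0,1])$ $$\frac{1}{\#\mathcal{A}_n}\sum_{k\in\mathcal{A}_n}f(c_k)\to\int_0^1 f(x)\phi(x)\,dx\qquad(n\to\infty);$$ and there is a sequence $q(n)$ of non-negative integers with $q(n)\to\infty$ such that - **A.2 (log-average spacing)** for every $\varepsilon>0$ there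 is $\delta>0$ such that for all large enough $n$ and all $n',n''\in\{n,2n,\dots,2^{q(n)}n\}$ $$\frac{1}{\#(\mathcal{A}_{n'}\times\mathcal{A}_{n''})}\sum(-\log|c_i-c_j|)<\varepsilon,$$ where the sum is over $i\in\mathcal{A}_{n'}$, $j\in\mathcal{A}_{n''}$ with $i\ne j$ and $|c_i-c_j|<\delta$ (with $-\log 0=+\infty$); - **A.3 (gap control)** for every $\varepsilon>0$, for all large enough $n$, every $i\neq j$ in $\mathcal{A}_{n,q(n)}$ satisfy $c_i\ne c_j$ and $$\frac{l_i+l_j}{2|c_i-c_j|}<\varepsilon.$$ Then the set $S=\bigcap_m\bigcup_{k\ge m}I_k$ is a subset of $[0,1]$ and has full capacity on it: $\mathrm{Cap}(S)=\mathrm{Cap}([0,1])>0$. -/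

import Mathlib

open Set Filter Topology MeasureTheory

noncomputable section

namespace LogCap

/-- The logarithmic kernel `-log |z - w|`, with value `+∞` on the diagonal. -/
def logKernel (z w : ℂ) : EReal := -ENNReal.log (edist z w)

/-- The interaction `∬ -log |z - w| dν(z) dμ(w)`, as the difference of the integrals of the
positive and the negative part of the kernel. For finite measures with compact support the
second integral is finite, so the difference is meaningful and takes values in `(-∞, +∞]`. -/
def interaction (ν μ : Measure ℂ) : EReal :=
  ((∫⁻ w, ∫⁻ z, (logKernel z w).toENNReal ∂ν ∂μ : ENNReal) : EReal) -
    ((∫⁻ w, ∫⁻ z, (-logKernel z w).toENNReal ∂ν ∂μ : ENNReal) : EReal)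

/-- The energy of a measure. -/
def energy (μ : Measure ℂ) : EReal := interaction μ μ

/-- Logarithmic capacity: `exp (-inf I(μ))`, the infimum over the Borel probability measures
whose support is a compact subset of `E` (here `exp (-∞) = 0` and `inf ∅ = +∞`). -/
def capacity (E : Set ℂ) : ENNReal :=
  EReal.exp (-(⨅ (μ : Measure ℂ) (_ : IsProbabilityMeasure μ) (_ : IsCompact μ.support)
    (_ : μ.support ⊆ E), energy μ))

/-- `E` is a subset of `J` of full capacity on `J`. -/
def HasFullCapacityOn (E J : Set ℂ) : Prop := E ⊆ J ∧ capacity E = capacity J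

/-- The unit interval as a subset of `ℂ`. -/
def unitInterval : Set ℂ := (fun x : ℝ => (x : ℂ)) '' Icc 0 1

/-- The open interval with center `c k` and length `l k`. -/
def interval (c l : ℕ → ℝ) (k : ℕ) : Set ℝ := Ioo (c k - l k / 2) (c k + l k / 2)

/-- The set `⋂ₘ ⋃_{k ≥ m} I_k`, as a subset of `ℂ`. -/
def limsupSet (c l : ℕ → ℝ) : Set ℂ :=
  (fun x : ℝ => (x : ℂ)) '' (⋂ m : ℕ, ⋃ k : ℕ, ⋃ _ : m ≤ k, interval c l k)

/-- The index block `{n, …, 2n - 1}`. -/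
def block (n : ℕ) : Finset ℕ := Finset.Ico n (2 * n)

/-- The union of the blocks of `n, 2n, …, 2^q n`. -/
def multiBlock (n q : ℕ) : Finset ℕ :=
  (Finset.range (q + 1)).biUnion fun s => block (2 ^ s * n)

/-- The centers are distributed with respect to the density `φ ∈ L¹([0,1])`, `φ > 0` a.e. -/
def Distributed (c : ℕ → ℝ) (φ : ℝ → ℝ) : Prop :=
  IntegrableOn φ (Icc 0 1) ∧ (∀ᵐ x ∂(volume.restrict (Icc (0 : ℝ) 1)), 0 < φ x) ∧
  ∀ f : ℝ → ℝ, ContinuousOn f (Icc 0 1) →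
    Tendsto (fun n : ℕ => (∑ k ∈ block n, f (c k)) / ((block n).card : ℝ)) atTop
      (𝓝 (∫ x in Icc (0 : ℝ) 1, f x * φ x))

/-- Log-average spacing. The clause `c i ≠ c j` says that no term of the sum is `-log 0 = +∞`. -/
def LogAverageSpacing (c : ℕ → ℝ) (q : ℕ → ℕ) : Prop :=
  ∀ ε : ℝ, 0 < ε → ∃ δ : ℝ, 0 < δ ∧ ∀ᶠ n : ℕ in atTop, ∀ s ≤ q n, ∀ t ≤ q n,
    (∀ i ∈ block (2 ^ s * n), ∀ j ∈ block (2 ^ t * n), i ≠ j → c i ≠ c j) ∧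
    (∑ p ∈ (block (2 ^ s * n) ×ˢ block (2 ^ t * n)).filter
        (fun p => p.1 ≠ p.2 ∧ |c p.1 - c p.2| < δ), -Real.log |c p.1 - c p.2|) /
      ((block (2 ^ s * n) ×ˢ block (2 ^ t * n)).card : ℝ) < ε

/-- Gap control. The clause `c i ≠ c j` says that the quotient is finite. -/
def GapControl (c l : ℕ → ℝ) (q : ℕ → ℕ) : Prop :=
  ∀ ε : ℝ, 0 < ε → ∀ᶠ n : ℕ in atTop,
    ∀ i ∈ multiBlock n (q n), ∀ j ∈ multiBlock n (q n), i ≠ j →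
      c i ≠ c j ∧ (l i + l j) / (2 * |c i - c j|) < ε

end LogCap

end

/-!
Since capacity is monotone, it suffices to find, for every probability measure `ν` on `[0, 1]` of
finite energy and every `ε > 0`, a measure of energy at most `I(ν) + ε` on a compact subset of the
limsup set.

After mollification `ν` is absolutely continuous. Distribute mass `g(c_k)` uniformly over the ball
of radius `l_k / 4` around `c_k`, for `k` in the blocks of `n, 2n, …, 2^q n`, each block carrying
weight `1 / (q + 1)`, where `g` is a continuous approximation of `dν / (φ dx)`. By A.1 these
measures converge to `ν`, and their energies converge as well: A.3 makes pairs of distinct balls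
interact almost as point masses at their centers, A.2 makes close pairs negligible, and the
self-energies, of order `λ k` for a ball of mass about `1 / (q k)`, contribute `O(1 / q)` in total.
It is this last point for which a single block (`q = 0`) would not suffice.

Each measure obtained in this way is again absolutely continuous and lives on a compact subset of
`⋃_{k ≥ m} I_k`, so the step can be iterated inside shrinking neighbourhoods with summable losses
of energy. A weak limit lives on a compact subset of all these unions, and its energy is controlled
by lower semicontinuity.
-/

open ProbabilityTheory
open scoped ENNReal NNReal BoundedContinuousFunction

noncomputable section

namespace LogCap

section MutualEnergy

variable {X Y : Type*} [MeasurableSpace X] [MeasurableSpace Y] {K L : X → X → ℝ≥0∞}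
  {ν ν' μ μ' : Measure X}

/-- The mutual energy `∬ K(x, y) dν(x) dμ(y)` of two measures for a nonnegative kernel `K`; the
energy of `μ` is its mutual energy with itself. -/
def mutualEnergy (K : X → X → ℝ≥0∞) (ν μ : Measure X) : ℝ≥0∞ := ∫⁻ y, ∫⁻ x, K x y ∂ν ∂μ

theorem mutualEnergy_mono (hν : ν ≤ ν') (hμ : μ ≤ μ') :
    mutualEnergy K ν μ ≤ mutualEnergy K ν' μ' :=
  lintegral_mono' hμ fun _ => lintegral_mono' hν le_rfl

theorem mutualEnergy_mono_kernel_ae (h : ∀ᵐ y ∂μ, ∀ᵐ x ∂ν, K x y ≤ L x y) :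
    mutualEnergy K ν μ ≤ mutualEnergy L ν μ :=
  lintegral_mono_ae (h.mono fun _ hy => lintegral_mono_ae hy)

theorem mutualEnergy_kernel_const (C : ℝ≥0∞) (ν μ : Measure X) :
    mutualEnergy (fun _ _ => C) ν μ = C * ν univ * μ univ := by
  simp [mutualEnergy]

theorem mutualEnergy_smul_right (a : ℝ≥0∞) :
    mutualEnergy K ν (a • μ) = a * mutualEnergy K ν μ :=
  lintegral_smul_measure _ _

theorem mutualEnergy_add_right :
    mutualEnergy K ν (μ + μ') = mutualEnergy K ν μ + mutualEnergy K ν μ' :=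
  lintegral_add_measure _ _ _

variable (hK : Measurable (Function.uncurry K)) [SFinite ν]
include hK

theorem measurable_lintegral_kernel : Measurable fun y => ∫⁻ x, K x y ∂ν :=
  Measurable.lintegral_prod_left' (f := fun p => K p.1 p.2) hK

theorem mutualEnergy_eq_lintegral_prod [SFinite μ] :
    mutualEnergy K ν μ = ∫⁻ p, K p.1 p.2 ∂(ν.prod μ) :=
  (lintegral_prod_symm' _ hK).symm

theorem mutualEnergy_comm [SFinite μ] (hsymm : ∀ x y, K x y = K y x) :
    mutualEnergy K ν μ = mutualEnergy K μ ν := by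
  rw [mutualEnergy, lintegral_lintegral_swap (f := fun y x => K x y)
    (hK.comp measurable_swap).aemeasurable]
  exact lintegral_congr fun x => lintegral_congr fun y => hsymm x y

theorem mutualEnergy_smul_left (a : ℝ≥0∞) :
    mutualEnergy K (a • ν) μ = a * mutualEnergy K ν μ := by
  simp only [mutualEnergy, lintegral_smul_measure, smul_eq_mul]
  exact lintegral_const_mul _ (measurable_lintegral_kernel hK)

theorem mutualEnergy_add_left :
    mutualEnergy K (ν + ν') μ = mutualEnergy K ν μ + mutualEnergy K ν' μ := by
  simp only [mutualEnergy, lintegral_add_measure]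
  exact lintegral_add_left (measurable_lintegral_kernel hK) _

theorem mutualEnergy_kernel_add :
    mutualEnergy (fun x y => K x y + L x y) ν μ = mutualEnergy K ν μ + mutualEnergy L ν μ := by
  simp only [mutualEnergy, lintegral_add_left hK.of_uncurry_right]
  exact lintegral_add_left (measurable_lintegral_kernel hK) _

theorem mutualEnergy_map {ν μ : Measure Y} [SFinite ν] {f : Y → X} (hf : Measurable f) :
    mutualEnergy K (ν.map f) (μ.map f) = mutualEnergy (fun x y => K (f x) (f y)) ν μ := by
  rw [mutualEnergy, lintegral_map (measurable_lintegral_kernel hK) hf]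
  exact lintegral_congr fun y => lintegral_map hK.of_uncurry_right hf

theorem mutualEnergy_withDensity {f : X → ℝ≥0∞} (hf : Measurable f) :
    mutualEnergy K (ν.withDensity f) (μ.withDensity f) =
      mutualEnergy (fun x y => f x * f y * K x y) ν μ := by
  rw [mutualEnergy, lintegral_withDensity_eq_lintegral_mul _ hf (measurable_lintegral_kernel hK)]
  refine lintegral_congr fun y => ?_
  rw [Pi.mul_apply, lintegral_withDensity_eq_lintegral_mul _ hf hK.of_uncurry_right,
    ← lintegral_const_mul _ (hf.mul hK.of_uncurry_right)]
  exact lintegral_congr fun x => by simp only [Pi.mul_apply]; ring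

theorem measurable_lintegral_kernel_apply (κ : Kernel Y X) [IsSFiniteKernel κ] :
    Measurable fun p : X × Y => ∫⁻ x, K x p.1 ∂(κ p.2) :=
  Measurable.lintegral_kernel_prod_right' (κ := κ.comap (fun p : X × Y => p.2) measurable_snd)
    (f := fun z => K z.2 z.1.1) (hK.comp (measurable_snd.prodMk (by fun_prop)))

theorem measurable_mutualEnergy_kernel_apply (κ : Kernel Y X) [IsSFiniteKernel κ] :
    Measurable fun p : Y × Y => mutualEnergy K (κ p.1) (κ p.2) :=
  Measurable.lintegral_kernel_prod_right' (κ := κ.comap Prod.snd measurable_snd)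
    (f := fun z : (Y × Y) × X => ∫⁻ x, K x z.2 ∂(κ z.1.1))
    ((measurable_lintegral_kernel_apply hK κ).comp
      (measurable_snd.prodMk (measurable_fst.comp measurable_fst)))

theorem mutualEnergy_bind (κ : Kernel Y X) [IsSFiniteKernel κ] {ν μ : Measure Y} [SFinite ν] :
    mutualEnergy K (ν.bind κ) (μ.bind κ) =
      mutualEnergy (fun x y => mutualEnergy K (κ x) (κ y)) ν μ := by
  have hpot : ∀ y, ∫⁻ x, K x y ∂(ν.bind κ) = ∫⁻ a, ∫⁻ x, K x y ∂(κ a) ∂ν := fun y =>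
    Measure.lintegral_bind κ.measurable.aemeasurable hK.of_uncurry_right.aemeasurable
  have hmeas := measurable_lintegral_kernel_apply hK κ
  simp only [mutualEnergy, hpot]
  rw [Measure.lintegral_bind κ.measurable.aemeasurable hmeas.lintegral_prod_right'.aemeasurable]
  exact lintegral_congr fun b => lintegral_lintegral_swap hmeas.aemeasurable

theorem mutualEnergy_eq_iSup_min :
    mutualEnergy K ν μ = ⨆ n : ℕ, mutualEnergy (fun x y => min (K x y) n) ν μ := by
  have hmeas : ∀ n : ℕ, Measurable (Function.uncurry fun x y => min (K x y) n) := fun n =>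
    hK.min measurable_const
  have hmono : Monotone fun (n : ℕ) (p : X × X) => min (K p.1 p.2) n := fun m n hmn p =>
    min_le_min le_rfl (Nat.cast_le.2 hmn)
  have hsup : ∀ x y, K x y = ⨆ n : ℕ, min (K x y) n := fun x y => by
    rw [← inf_iSup_eq, ENNReal.iSup_natCast, inf_top_eq]
  calc mutualEnergy K ν μ = ∫⁻ y, ⨆ n : ℕ, ∫⁻ x, min (K x y) n ∂ν ∂μ :=
        lintegral_congr fun y => (lintegral_congr fun x => hsup x y).trans <|
          lintegral_iSup (fun n => (hmeas n).of_uncurry_right) fun m n hmn x => hmono hmn (x, y)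
    _ = ⨆ n : ℕ, mutualEnergy (fun x y => min (K x y) n) ν μ :=
        lintegral_iSup (fun n => measurable_lintegral_kernel (hmeas n)) fun m n hmn y =>
          lintegral_mono fun x => hmono hmn (x, y)

/-- Bilinearity applied to `μ ≤ ν + τ`, once in each variable. -/
theorem mutualEnergy_self_le_of_le_add {τ : Measure X} [SFinite τ] {Φ : Measure X}
    [SFinite Φ] (hsymm : ∀ x y, K x y = K y x) {M : ℝ≥0∞} (hν : ν ≤ M • Φ) (hμ : μ ≤ M • Φ)
    (h : μ ≤ ν + τ) :
    mutualEnergy K μ μ ≤ mutualEnergy K ν ν + 2 * M * mutualEnergy K Φ τ := by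
  calc mutualEnergy K μ μ
      ≤ mutualEnergy K (ν + τ) μ := mutualEnergy_mono h le_rfl
    _ = mutualEnergy K ν μ + mutualEnergy K τ μ := mutualEnergy_add_left hK
    _ ≤ mutualEnergy K ν (ν + τ) + mutualEnergy K τ (M • Φ) :=
        add_le_add (mutualEnergy_mono le_rfl h) (mutualEnergy_mono le_rfl hμ)
    _ = mutualEnergy K ν ν + mutualEnergy K ν τ + M * mutualEnergy K Φ τ := by
        rw [mutualEnergy_add_right, mutualEnergy_smul_right, mutualEnergy_comm hK hsymm (ν := τ)]
    _ ≤ mutualEnergy K ν ν + M * mutualEnergy K Φ τ + M * mutualEnergy K Φ τ := by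
        gcongr
        exact (mutualEnergy_mono hν le_rfl).trans_eq (mutualEnergy_smul_left hK M)
    _ = mutualEnergy K ν ν + 2 * M * mutualEnergy K Φ τ := by rw [add_assoc, two_mul, add_mul]

end MutualEnergy

section WeakConvergence

variable {X ι : Type*} [TopologicalSpace X] [MeasurableSpace X]
  [OpensMeasurableSpace X] {K : X → X → ℝ≥0∞} {l : Filter ι} {μ : ι → ProbabilityMeasure X}
  {μ₀ : ProbabilityMeasure X} {M : ℝ≥0}

theorem tendsto_lintegral_of_continuous_of_le {f : X → ℝ≥0∞} (hf : Continuous f)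
    (hM : ∀ x, f x ≤ M) (h : Tendsto μ l (𝓝 μ₀)) :
    Tendsto (fun i => ∫⁻ x, f x ∂(μ i)) l (𝓝 (∫⁻ x, f x ∂μ₀)) := by
  have hfin : ∀ x, f x ≠ ∞ := fun x => ((hM x).trans_lt ENNReal.coe_lt_top).ne
  have hle : ∀ x, (f x).toNNReal ≤ M := fun x => ENNReal.toNNReal_mono ENNReal.coe_ne_top (hM x)
  let g : X →ᵇ ℝ≥0 := BoundedContinuousFunction.mkOfBound
    ⟨fun x => (f x).toNNReal, ENNReal.continuousOn_toNNReal.comp_continuous hf hfin⟩ M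
    fun x y => by
      rw [← coe_nndist, NNReal.nndist_eq]
      exact NNReal.coe_le_coe.2 (max_le (tsub_le_self.trans (hle x)) (tsub_le_self.trans (hle y)))
  have hg : ∀ x, f x = g x := fun x => (ENNReal.coe_toNNReal (hfin x)).symm
  simp only [hg]
  exact ProbabilityMeasure.tendsto_iff_forall_lintegral_tendsto.1 h g

variable [SecondCountableTopology X] [TopologicalSpace.PseudoMetrizableSpace X]

theorem tendsto_mutualEnergy_of_continuous_of_le (hK : Continuous (Function.uncurry K))
    (hM : ∀ x y, K x y ≤ M) (h : Tendsto μ l (𝓝 μ₀)) :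
    Tendsto (fun i => mutualEnergy K (μ i) (μ i)) l (𝓝 (mutualEnergy K μ₀ μ₀)) := by
  have hprod := (ProbabilityMeasure.continuous_prod.tendsto (μ₀, μ₀)).comp (h.prodMk_nhds h)
  simp only [mutualEnergy_eq_lintegral_prod hK.measurable, ← ProbabilityMeasure.toMeasure_prod]
  exact tendsto_lintegral_of_continuous_of_le hK (fun p => hM p.1 p.2) hprod

theorem eventually_mutualEnergy_mul_min_le (hK : Continuous (Function.uncurry K))
    (h : Tendsto μ l (𝓝 μ₀)) {g : X → ℝ≥0} (hg : Continuous g) (hB : ∀ x, g x ≤ M) {a : ℝ≥0∞}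
    (ha : a ≠ ∞) {η : ℝ≥0} (hη : η ≠ 0) :
    ∀ᶠ i in l, mutualEnergy (fun x y => g x * g y * min (K x y) a) (μ i : Measure X) (μ i) ≤
      mutualEnergy K ((μ₀ : Measure X).withDensity fun x => g x)
        ((μ₀ : Measure X).withDensity fun x => g x) + η := by
  let T : X → X → ℝ≥0∞ := fun x y => g x * g y * min (K x y) a
  have hgg : Continuous fun p : X × X => (g p.1 * g p.2 : ℝ≥0∞) := by
    simp only [← ENNReal.coe_mul]
    fun_prop
  have hT : Continuous (Function.uncurry T) := continuous_iff_continuousAt.2 fun p =>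
    ENNReal.Tendsto.mul (hgg.tendsto p) (Or.inr (ne_top_of_le_ne_top ha (min_le_right _ _)))
      (Continuous.tendsto (hK.min continuous_const) p) (Or.inr (by finiteness))
  have hTM : ∀ x y, T x y ≤ (M * M * a.toNNReal : ℝ≥0) := fun x y => by
    rw [ENNReal.coe_mul, ENNReal.coe_mul, ENNReal.coe_toNNReal ha]
    exact mul_le_mul' (mul_le_mul' (ENNReal.coe_le_coe.2 (hB x)) (ENNReal.coe_le_coe.2 (hB y)))
      (min_le_right _ _)
  have hTμ₀ : mutualEnergy T (μ₀ : Measure X) μ₀ ≤ mutualEnergy K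
      ((μ₀ : Measure X).withDensity fun x => g x) ((μ₀ : Measure X).withDensity fun x => g x) := by
    rw [mutualEnergy_withDensity hK.measurable hg.measurable.coe_nnreal_ennreal]
    exact lintegral_mono fun y => lintegral_mono fun x => mul_le_mul' le_rfl (min_le_left _ _)
  have hTfin : mutualEnergy T (μ₀ : Measure X) μ₀ ≠ ∞ :=
    ne_top_of_le_ne_top (b := (M * M * a.toNNReal : ℝ≥0)) ENNReal.coe_ne_top <|
      (mutualEnergy_mono_kernel_ae (ae_of_all _ fun y => ae_of_all _ fun x => hTM x y)).trans_eq <|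
        by rw [mutualEnergy_kernel_const, measure_univ, mul_one, mul_one]
  filter_upwards [(tendsto_mutualEnergy_of_continuous_of_le hT hTM h).eventually_lt_const
    (ENNReal.lt_add_right hTfin (ENNReal.coe_ne_zero.2 hη))] with i hi
  exact hi.le.trans (add_le_add_left hTμ₀ _)

theorem mutualEnergy_le_of_tendsto [l.NeBot] (hK : Continuous (Function.uncurry K))
    (h : Tendsto μ l (𝓝 μ₀)) {C : ℝ≥0∞} (hC : ∀ i, mutualEnergy K (μ i) (μ i) ≤ C) :
    mutualEnergy K μ₀ μ₀ ≤ C := by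
  rw [mutualEnergy_eq_iSup_min hK.measurable]
  refine iSup_le fun n => le_of_tendsto (tendsto_mutualEnergy_of_continuous_of_le (M := n)
    (hK.min continuous_const) (fun x y => min_le_right _ _) h) (Eventually.of_forall fun i => ?_)
  exact (lintegral_mono fun y => lintegral_mono fun x => min_le_left _ _).trans (hC i)

end WeakConvergence

section WeakLimit

variable {X : Type*} [TopologicalSpace X] [MeasurableSpace X] [BorelSpace X] [T2Space X]
  [SecondCountableTopology X] [TopologicalSpace.PseudoMetrizableSpace X] {K : X → X → ℝ≥0∞}

theorem exists_ae_mem_iInter_of_isCompact {μ : ℕ → ProbabilityMeasure X} {F : ℕ → Set X}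
    (hF : ∀ n, IsCompact (F n)) (hanti : Antitone F) (hμ : ∀ n, ∀ᵐ x ∂(μ n : Measure X), x ∈ F n)
    (hK : Continuous (Function.uncurry K)) {C : ℝ≥0∞} (hC : ∀ n, mutualEnergy K (μ n) (μ n) ≤ C) :
    ∃ μ₀ : ProbabilityMeasure X, (∀ᵐ x ∂(μ₀ : Measure X), x ∈ ⋂ n, F n) ∧
      mutualEnergy K μ₀ μ₀ ≤ C := by
  have hmem : ∀ m n, m ≤ n → (μ n : Measure X) (F m)ᶜ = 0 := fun m n hmn =>
    (hμ n).mono fun x hx => hanti hmn hx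
  have htight : IsTightMeasureSet {((ν : ProbabilityMeasure X) : Measure X) | ν ∈ range μ} := by
    refine isTightMeasureSet_iff_exists_isCompact_measure_compl_le.2 fun ε _ => ⟨F 0, hF 0, ?_⟩
    rintro _ ⟨_, ⟨n, rfl⟩, rfl⟩
    exact (hmem 0 n n.zero_le).trans_le zero_le
  obtain ⟨μ₀, -, hμ₀⟩ := (isCompact_closure_of_isTightMeasureSet htight).ultrafilter_le_nhds
    ((hyperfilter ℕ).map μ) (le_principal_iff.2 <|
      Filter.mem_map.2 (univ_mem' fun n => subset_closure (mem_range_self n)))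
  have hlim : Tendsto μ (hyperfilter ℕ : Filter ℕ) (𝓝 μ₀) := hμ₀
  refine ⟨μ₀, ?_, mutualEnergy_le_of_tendsto hK hlim hC⟩
  simp only [mem_iInter]
  refine ae_all_iff.2 fun m => ?_
  have hzero : Tendsto (fun n => (μ n : Measure X) (F m)ᶜ) (hyperfilter ℕ : Filter ℕ) (𝓝 0) :=
    tendsto_const_nhds.congr' <|
      ((eventually_ge_atTop m).filter_mono Nat.hyperfilter_le_atTop).mono
        fun n hn => (hmem m n hn).symm
  have hliminf := ProbabilityMeasure.le_liminf_measure_open_of_tendsto hlim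
    (hF m).isClosed.isOpen_compl
  exact le_antisymm (hliminf.trans_eq hzero.liminf_eq) zero_le

theorem exists_ae_mem_iInter_of_forall_exists [LocallyCompactSpace X]
    (hK : Continuous (Function.uncurry K)) {P : ProbabilityMeasure X → Prop} {G : ℕ → Set X}
    (hG : ∀ m, IsOpen (G m))
    (hstep : ∀ ν : ProbabilityMeasure X, P ν →
      ∀ U : Set X, IsOpen U → (∀ᵐ x ∂(ν : Measure X), x ∈ U) → ∀ m : ℕ, ∀ ε : ℝ≥0, ε ≠ 0 →
        ∃ (ν' : ProbabilityMeasure X) (F : Set X), P ν' ∧ IsCompact F ∧ F ⊆ U ∩ G m ∧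
          (∀ᵐ x ∂(ν' : Measure X), x ∈ F) ∧ mutualEnergy K ν' ν' ≤ mutualEnergy K ν ν + ε)
    {ν : ProbabilityMeasure X} (hν : P ν) {ε : ℝ≥0∞} (hε : ε ≠ 0) :
    ∃ (μ : ProbabilityMeasure X) (F : Set X), IsCompact F ∧ F ⊆ ⋂ m, G m ∧
      (∀ᵐ x ∂(μ : Measure X), x ∈ F) ∧ mutualEnergy K μ μ ≤ mutualEnergy K ν ν + ε := by
  obtain ⟨e, he0, he⟩ := ENNReal.exists_pos_sum_of_countable hε ℕ
  let S := {s : ProbabilityMeasure X × Set X //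
    P s.1 ∧ IsOpen s.2 ∧ ∀ᵐ x ∂(s.1 : Measure X), x ∈ s.2}
  have hnext : ∀ (m : ℕ) (s : S), ∃ s' : S, IsCompact (closure s'.1.2) ∧
      closure s'.1.2 ⊆ s.1.2 ∩ G m ∧
      mutualEnergy K s'.1.1 s'.1.1 ≤ mutualEnergy K s.1.1 s.1.1 + e m := by
    rintro m ⟨⟨ν, U⟩, hP, hU, hνU⟩
    obtain ⟨ν', F, hP', hF, hFU, hνF, hE⟩ := hstep ν hP U hU hνU m (e m) (he0 m).ne'
    obtain ⟨V, hV, hFV, hVU, hVc⟩ := exists_open_between_and_isCompact_closure hF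
      (hU.inter (hG m)) hFU
    exact ⟨⟨(ν', V), hP', hV, hνF.mono fun x hx => hFV hx⟩, hVc, hVU, hE⟩
  choose next hcompact hsub henergy using hnext
  let s : ℕ → S := fun n => Nat.rec ⟨(ν, univ), hν, isOpen_univ, by simp⟩ next n
  have hE : ∀ n, mutualEnergy K (s n).1.1 (s n).1.1 ≤
      mutualEnergy K ν ν + ∑ m ∈ Finset.range n, (e m : ℝ≥0∞) := fun n => by
    induction n with
    | zero => simp [s]
    | succ n ih =>
      rw [Finset.sum_range_succ, ← add_assoc]
      exact (henergy n (s n)).trans (by gcongr)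
  have hanti : Antitone fun n => closure (s (n + 1)).1.2 :=
    antitone_nat_of_succ_le fun n x hx => subset_closure (hsub (n + 1) _ hx).1
  obtain ⟨μ, hμ, hμE⟩ := exists_ae_mem_iInter_of_isCompact (fun n => hcompact n (s n)) hanti
    (fun n => (s (n + 1)).2.2.2.mono fun x hx => subset_closure hx) hK
    fun n => (hE (n + 1)).trans (add_le_add le_rfl ((ENNReal.sum_le_tsum _).trans he.le))
  exact ⟨μ, ⋂ n, closure (s (n + 1)).1.2, (hcompact 0 (s 0)).of_isClosed_subset
      (isClosed_iInter fun _ => isClosed_closure) (iInter_subset _ 0),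
    iInter_mono fun m x hx => (hsub m (s m) hx).2, hμ, hμE⟩

end WeakLimit

section PosLogKernel

variable {X Y : Type*}

/-- The positive part of the logarithmic kernel `-log (dist x y)` of a metric space, with value `∞`
on the diagonal. Only this part matters for sets of diameter at most `1`. -/
def posLogKernel [PseudoEMetricSpace X] (x y : X) : ℝ≥0∞ := (-ENNReal.log (edist x y)).toENNReal

theorem continuous_posLogKernel [PseudoEMetricSpace X] :
    Continuous (Function.uncurry (posLogKernel (X := X))) :=
  (continuous_neg.comp <|
    ENNReal.continuous_log.comp (continuous_fst.edist continuous_snd)).ereal_toENNReal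

theorem measurable_posLogKernel [PseudoEMetricSpace X] [SecondCountableTopology X]
    [MeasurableSpace X] [OpensMeasurableSpace X] :
    Measurable (Function.uncurry (posLogKernel (X := X))) :=
  continuous_posLogKernel.measurable

theorem posLogKernel_comm [PseudoEMetricSpace X] (x y : X) :
    posLogKernel x y = posLogKernel y x := by
  rw [posLogKernel, edist_comm, posLogKernel]

variable [PseudoMetricSpace X] [PseudoMetricSpace Y]

theorem posLogKernel_of_dist_eq_zero {x y : X} (h : dist x y = 0) : posLogKernel x y = ∞ := by
  simp [posLogKernel, edist_dist, h]

theorem posLogKernel_of_dist_pos {x y : X} (h : 0 < dist x y) :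
    posLogKernel x y = ENNReal.ofReal (-Real.log (dist x y)) := by
  rw [posLogKernel, edist_dist, ENNReal.log_ofReal_of_pos h, ← EReal.coe_neg,
    EReal.toENNReal_of_ne_top (EReal.coe_ne_top _), EReal.toReal_coe]

theorem posLogKernel_le_of_le_dist {x y : X} {r : ℝ} (hr : 0 < r) (h : r ≤ dist x y) :
    posLogKernel x y ≤ ENNReal.ofReal (-Real.log r) := by
  rw [posLogKernel_of_dist_pos (hr.trans_le h)]
  exact ENNReal.ofReal_le_ofReal (neg_le_neg (Real.log_le_log hr h))

theorem ofReal_neg_log_mul_le {a b : ℝ} (ha : 0 < a) (hb : 0 < b) :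
    ENNReal.ofReal (-Real.log (a * b)) ≤
      ENNReal.ofReal (-Real.log a) + ENNReal.ofReal (-Real.log b) := by
  rw [Real.log_mul ha.ne' hb.ne', neg_add]
  exact ENNReal.ofReal_add_le

theorem posLogKernel_le_of_mul_dist_le {x y : X} {x' y' : Y} {a : ℝ} (ha : 0 < a)
    (h : a * dist x' y' ≤ dist x y) :
    posLogKernel x y ≤ ENNReal.ofReal (-Real.log a) + posLogKernel x' y' := by
  rcases (dist_nonneg (x := x') (y := y')).eq_or_lt with h0 | hpos
  · simp [posLogKernel_of_dist_eq_zero h0.symm]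
  · rw [posLogKernel_of_dist_pos hpos]
    exact (posLogKernel_le_of_le_dist (mul_pos ha hpos) h).trans (ofReal_neg_log_mul_le ha hpos)

end PosLogKernel

section Potential

theorem lintegral_posLogKernel_volume_le (y : ℝ) : ∫⁻ x, posLogKernel x y ≤ 2 := by
  have htranslate : ∫⁻ x, posLogKernel x y = ∫⁻ u : ℝ, posLogKernel u 0 := by
    rw [← lintegral_sub_right_eq_self (fun u => posLogKernel u 0) y]
    exact lintegral_congr fun x => by simp [posLogKernel, edist_dist, Real.dist_eq]
  have hlog : ∀ u ∈ Ioc (-1 : ℝ) 1, 0 ≤ -Real.log u := fun u hu => by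
    rw [← Real.log_abs, neg_nonneg]
    exact Real.log_nonpos (abs_nonneg u) (abs_le.2 ⟨hu.1.le, hu.2⟩)
  have hle : ∀ᵐ u : ℝ, posLogKernel u 0 ≤
      (Ioc (-1 : ℝ) 1).indicator (fun u => ENNReal.ofReal (-Real.log u)) u := by
    filter_upwards [compl_mem_ae_iff.2 (measure_singleton (0 : ℝ))] with u hu
    rw [posLogKernel_of_dist_pos (dist_pos.2 hu), Real.dist_eq, sub_zero, Real.log_abs]
    by_cases hmem : u ∈ Ioc (-1 : ℝ) 1
    · rw [indicator_of_mem hmem]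
    · have habs : 1 ≤ |u| := by
        by_contra! hlt
        exact hmem ⟨(abs_lt.1 hlt).1, (abs_lt.1 hlt).2.le⟩
      rw [← Real.log_abs, ENNReal.ofReal_of_nonpos (neg_nonpos.2 (Real.log_nonneg habs))]
      exact zero_le
  have hint : IntegrableOn (fun u => -Real.log u) (Ioc (-1) 1) := by
    rw [← intervalIntegrable_iff_integrableOn_Ioc_of_le (by norm_num)]
    exact intervalIntegral.intervalIntegrable_log'.neg
  calc ∫⁻ x, posLogKernel x y = ∫⁻ u : ℝ, posLogKernel u 0 := htranslate
    _ ≤ ∫⁻ u in Ioc (-1 : ℝ) 1, ENNReal.ofReal (-Real.log u) :=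
        (lintegral_mono_ae hle).trans_eq (lintegral_indicator measurableSet_Ioc _)
    _ = ENNReal.ofReal (∫ u in Ioc (-1 : ℝ) 1, -Real.log u) :=
        (ofReal_integral_eq_lintegral_ofReal hint
          ((ae_restrict_iff' measurableSet_Ioc).2 (Eventually.of_forall hlog))).symm
    _ = 2 := by
        rw [← intervalIntegral.integral_of_le (by norm_num), intervalIntegral.integral_neg,
          integral_log]
        norm_num

theorem lintegral_posLogKernel_le_of_le_smul_volume {ν : Measure ℝ} [IsProbabilityMeasure ν]
    {t : ℝ} (ht : 0 < t) (hν : ν ≤ (ENNReal.ofReal t)⁻¹ • volume) (y : ℝ) :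
    ∫⁻ x, posLogKernel x y ∂ν ≤ ENNReal.ofReal (-Real.log t) + 2 := by
  have hscale : ∀ x, posLogKernel x y ≤
      ENNReal.ofReal (-Real.log t) + posLogKernel (t⁻¹ • x) (t⁻¹ • y) := fun x =>
    posLogKernel_le_of_mul_dist_le ht <| by
      rw [dist_smul₀, norm_inv, Real.norm_of_nonneg ht.le, mul_inv_cancel_left₀ ht.ne']
  have hvolume : (ENNReal.ofReal t)⁻¹ * ∫⁻ x, posLogKernel (t⁻¹ • x) (t⁻¹ • y) ≤ 2 := by
    have hmap := Real.smul_map_volume_mul_left (inv_ne_zero ht.ne')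
    rw [abs_of_pos (inv_pos.2 ht), ENNReal.ofReal_inv_of_pos ht] at hmap
    refine le_trans (le_of_eq ?_) (lintegral_posLogKernel_volume_le (t⁻¹ • y))
    conv_rhs => rw [← hmap, lintegral_smul_measure,
      lintegral_map measurable_posLogKernel.of_uncurry_right (measurable_const_mul _)]
    rfl
  calc ∫⁻ x, posLogKernel x y ∂ν
      ≤ ∫⁻ x, (ENNReal.ofReal (-Real.log t) + posLogKernel (t⁻¹ • x) (t⁻¹ • y)) ∂ν :=
        lintegral_mono hscale
    _ = ENNReal.ofReal (-Real.log t) + ∫⁻ x, posLogKernel (t⁻¹ • x) (t⁻¹ • y) ∂ν := by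
        rw [lintegral_add_left measurable_const, lintegral_const, measure_univ, mul_one]
    _ ≤ ENNReal.ofReal (-Real.log t) + 2 := by
        gcongr
        refine (lintegral_mono' hν le_rfl).trans ?_
        rwa [lintegral_smul_measure]

end Potential

section UniformBall

/-- The uniform probability measure on the interval `[a - r, a + r]`. -/
def uniformBall (a r : ℝ) : Measure ℝ := volume[|Metric.closedBall a r]

variable {a b r s : ℝ}

theorem isProbabilityMeasure_uniformBall (hr : 0 < r) : IsProbabilityMeasure (uniformBall a r) :=
  cond_isProbabilityMeasure_of_finite (by simp [hr]) measure_closedBall_lt_top.ne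

theorem uniformBall_absolutelyContinuous (a r : ℝ) : uniformBall a r ≪ volume :=
  cond_absolutelyContinuous

theorem ae_mem_closedBall_uniformBall (a r : ℝ) :
    ∀ᵐ x ∂(uniformBall a r), x ∈ Metric.closedBall a r :=
  ae_cond_mem Metric.isClosed_closedBall.measurableSet

theorem uniformBall_le_smul_volume (a r : ℝ) :
    uniformBall a r ≤ (ENNReal.ofReal (2 * r))⁻¹ • volume := by
  rw [uniformBall, ProbabilityTheory.cond, Real.volume_closedBall]
  gcongr
  exact Measure.restrict_le_self

theorem measurable_uniformBall {Ω : Type*} [MeasurableSpace Ω] {a r : Ω → ℝ} (ha : Measurable a)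
    (hr : Measurable r) : Measurable fun ω => uniformBall (a ω) (r ω) := by
  refine Measure.measurable_of_measurable_coe _ fun s hs => ?_
  have hset : MeasurableSet {p : Ω × ℝ | p.2 ∈ Metric.closedBall (a p.1) (r p.1) ∩ s} :=
    (measurableSet_le (by fun_prop) (by fun_prop)).inter (measurable_snd hs)
  simp only [uniformBall, cond_apply Metric.isClosed_closedBall.measurableSet,
    Real.volume_closedBall]
  exact (by fun_prop : Measurable fun ω => (ENNReal.ofReal (2 * r ω))⁻¹).mul
    (measurable_measure_prodMk_left hset)

theorem mutualEnergy_uniformBall_le (hr : 0 < r) (a : ℝ) (μ : Measure ℝ)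
    [IsProbabilityMeasure μ] :
    mutualEnergy posLogKernel (uniformBall a r) μ ≤ ENNReal.ofReal (-Real.log (2 * r)) + 2 := by
  have := isProbabilityMeasure_uniformBall (a := a) hr
  refine (lintegral_mono fun y => lintegral_posLogKernel_le_of_le_smul_volume
    (by positivity) (uniformBall_le_smul_volume a r) y).trans_eq ?_
  rw [lintegral_const, measure_univ, mul_one]

theorem mutualEnergy_uniformBall_le_of_add_le (hr : 0 < r) (hs : 0 < s) {θ : ℝ} (hθ : 0 < θ)
    (h : r + s ≤ (1 - θ) * dist a b) :
    mutualEnergy posLogKernel (uniformBall a r) (uniformBall b s) ≤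
      ENNReal.ofReal (-Real.log θ) + posLogKernel a b := by
  have := isProbabilityMeasure_uniformBall (a := a) hr
  have := isProbabilityMeasure_uniformBall (a := b) hs
  have hsep : ∀ᵐ y ∂(uniformBall b s), ∀ᵐ x ∂(uniformBall a r),
      posLogKernel x y ≤ ENNReal.ofReal (-Real.log θ) + posLogKernel a b := by
    filter_upwards [ae_mem_closedBall_uniformBall b s] with y hy
    filter_upwards [ae_mem_closedBall_uniformBall a r] with x hx
    refine posLogKernel_le_of_mul_dist_le hθ ?_
    linarith [dist_triangle4 a x y b, Metric.mem_closedBall'.1 hx, Metric.mem_closedBall.1 hy]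
  refine (mutualEnergy_mono_kernel_ae hsep).trans_eq ?_
  rw [mutualEnergy_kernel_const, measure_univ, measure_univ, mul_one, mul_one]

end UniformBall

section Smoothing

/-- The Markov kernel `ω ↦ uniformBall (a ω) (r ω)`; integrating it against a measure spreads that
measure out by the radii `r`. -/
def uniformBallKernel {Ω : Type*} [MeasurableSpace Ω] {a r : Ω → ℝ} (ha : Measurable a)
    (hr : Measurable r) : Kernel Ω ℝ :=
  ⟨fun ω => uniformBall (a ω) (r ω), measurable_uniformBall ha hr⟩

theorem isMarkovKernel_uniformBallKernel {Ω : Type*} [MeasurableSpace Ω] {a r : Ω → ℝ}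
    (ha : Measurable a) (hr : Measurable r) (hpos : ∀ ω, 0 < r ω) :
    IsMarkovKernel (uniformBallKernel ha hr) :=
  ⟨fun ω => isProbabilityMeasure_uniformBall (hpos ω)⟩

theorem mutualEnergy_uniformBall_le_posLogKernel_add {r : ℝ} (hr : 0 < r) (a b : ℝ) :
    mutualEnergy posLogKernel (uniformBall a r) (uniformBall b r) ≤
      posLogKernel a b + (ENNReal.ofReal (-Real.log (1 / 2)) + 2) := by
  rcases (dist_nonneg (x := a) (y := b)).eq_or_lt with h0 | hpos
  · simp [posLogKernel_of_dist_eq_zero h0.symm]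
  rcases le_total (4 * r) (dist a b) with hfar | hnear
  · refine (mutualEnergy_uniformBall_le_of_add_le hr hr one_half_pos (by linarith)).trans ?_
    rw [add_comm, ← add_assoc]
    exact le_self_add
  · have := isProbabilityMeasure_uniformBall (a := b) hr
    have hlog : ENNReal.ofReal (-Real.log (2 * r)) ≤
        ENNReal.ofReal (-Real.log (1 / 2)) + ENNReal.ofReal (-Real.log (dist a b)) :=
      (ENNReal.ofReal_le_ofReal <| neg_le_neg <|
        Real.log_le_log (by positivity) (by linarith)).trans
        (ofReal_neg_log_mul_le one_half_pos hpos)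
    calc mutualEnergy posLogKernel (uniformBall a r) (uniformBall b r)
        ≤ ENNReal.ofReal (-Real.log (2 * r)) + 2 := mutualEnergy_uniformBall_le hr a _
      _ ≤ ENNReal.ofReal (-Real.log (1 / 2)) + ENNReal.ofReal (-Real.log (dist a b)) + 2 := by
          gcongr
      _ = posLogKernel a b + (ENNReal.ofReal (-Real.log (1 / 2)) + 2) := by
          rw [posLogKernel_of_dist_pos hpos]; ring

theorem limsup_mutualEnergy_uniformBall_le {ι : Type*} {u : Filter ι} {r : ι → ℝ}
    (hr : Tendsto r u (𝓝[>] 0)) (a b : ℝ) :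
    limsup (fun i => mutualEnergy posLogKernel (uniformBall a (r i)) (uniformBall b (r i))) u ≤
      posLogKernel a b := by
  rcases u.eq_or_neBot with rfl | _
  · simp
  rcases (dist_nonneg (x := a) (y := b)).eq_or_lt with h0 | hpos
  · simp [posLogKernel_of_dist_eq_zero h0.symm]
  have hθ : Tendsto (fun i => 1 - 2 * r i / dist a b) u (𝓝 1) := by
    simpa using tendsto_const_nhds.sub
      ((((tendsto_nhdsWithin_iff.1 hr).1).const_mul 2).div_const (dist a b))
  have hbound : Tendsto (fun i => ENNReal.ofReal (-Real.log (1 - 2 * r i / dist a b)) +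
      posLogKernel a b) u (𝓝 (posLogKernel a b)) := by
    simpa using (ENNReal.tendsto_ofReal (hθ.log one_ne_zero).neg).add_const (posLogKernel a b)
  rw [← hbound.limsup_eq]
  refine limsup_le_limsup ?_
  filter_upwards [(tendsto_nhdsWithin_iff.1 hr).2, hθ.eventually (lt_mem_nhds one_pos)]
    with i hri hθi
  refine mutualEnergy_uniformBall_le_of_add_le hri hri hθi (le_of_eq ?_)
  field_simp
  ring

theorem eventually_mutualEnergy_bind_uniformBallKernel_lt (ν : Measure ℝ) [IsProbabilityMeasure ν]
    (hν : mutualEnergy posLogKernel ν ν ≠ ∞) {ε : ℝ≥0∞} (hε : ε ≠ 0) {r : ℕ → ℝ}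
    (hpos : ∀ n, 0 < r n) (hr : Tendsto r atTop (𝓝 0)) :
    ∀ᶠ n in atTop,
      mutualEnergy posLogKernel
        (uniformBallKernel measurable_id (measurable_const (a := r n)) ∘ₘ ν)
        (uniformBallKernel measurable_id (measurable_const (a := r n)) ∘ₘ ν)
      < mutualEnergy posLogKernel ν ν + ε := by
  have hK := measurable_posLogKernel (X := ℝ)
  let κ : ℕ → Kernel ℝ ℝ := fun n => uniformBallKernel measurable_id (measurable_const (a := r n))
  have (n : ℕ) : IsMarkovKernel (κ n) := isMarkovKernel_uniformBallKernel _ _ fun _ => hpos n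
  have henergy : ∀ n, mutualEnergy posLogKernel (κ n ∘ₘ ν) (κ n ∘ₘ ν) =
      ∫⁻ p, mutualEnergy posLogKernel (κ n p.1) (κ n p.2) ∂(ν.prod ν) := fun n => by
    rw [mutualEnergy_bind hK, mutualEnergy_eq_lintegral_prod]
    exact measurable_mutualEnergy_kernel_apply hK (κ n)
  refine eventually_lt_of_limsup_lt (lt_of_le_of_lt ?_ (ENNReal.lt_add_right hν hε))
  change limsup (fun n => mutualEnergy posLogKernel (κ n ∘ₘ ν) (κ n ∘ₘ ν)) atTop ≤ _
  rw [funext henergy, mutualEnergy_eq_lintegral_prod hK]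
  refine (limsup_lintegral_le _ (fun n => measurable_mutualEnergy_kernel_apply hK (κ n))
    (fun n => ae_of_all _ fun p => mutualEnergy_uniformBall_le_posLogKernel_add (hpos n) p.1 p.2)
    ?_).trans (lintegral_mono fun p => limsup_mutualEnergy_uniformBall_le
      (tendsto_nhdsWithin_iff.2 ⟨hr, Eventually.of_forall hpos⟩) p.1 p.2)
  rw [lintegral_add_right _ measurable_const, lintegral_const, measure_univ, mul_one,
    ← mutualEnergy_eq_lintegral_prod hK]
  simp [hν]

theorem mutualEnergy_map_le_of_mul_dist_le {ν : Measure ℝ} [IsProbabilityMeasure ν] {f : ℝ → ℝ}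
    (hf : Measurable f) {a : ℝ} (ha : 0 < a) (h : ∀ x y, a * dist x y ≤ dist (f x) (f y)) :
    mutualEnergy posLogKernel (ν.map f) (ν.map f) ≤
      ENNReal.ofReal (-Real.log a) + mutualEnergy posLogKernel ν ν := by
  rw [mutualEnergy_map measurable_posLogKernel hf]
  refine (mutualEnergy_mono_kernel_ae <| ae_of_all _ fun y => ae_of_all _ fun x =>
    posLogKernel_le_of_mul_dist_le ha (h x y)).trans_eq ?_
  rw [mutualEnergy_kernel_add (measurable_const (a := ENNReal.ofReal (-Real.log a))),
    mutualEnergy_kernel_const, measure_univ, mul_one, mul_one]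

theorem exists_ae_mem_Icc_mutualEnergy_le (ν : Measure ℝ) [IsProbabilityMeasure ν]
    (hν : ∀ᵐ x ∂ν, x ∈ Icc (0 : ℝ) 1) {ε : ℝ≥0∞} (hε : ε ≠ 0) :
    ∃ (ν' : ProbabilityMeasure ℝ) (s : ℝ), 0 < s ∧
      (∀ᵐ x ∂(ν' : Measure ℝ), x ∈ Icc s (1 - s)) ∧
      mutualEnergy (posLogKernel (X := ℝ)) ν' ν' ≤ mutualEnergy posLogKernel ν ν + ε := by
  have hlog : Tendsto (fun s : ℝ => ENNReal.ofReal (-Real.log (1 - 2 * s))) (𝓝[>] 0) (𝓝 0) := by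
    have : ContinuousAt (fun s : ℝ => ENNReal.ofReal (-Real.log (1 - 2 * s))) 0 := by
      refine ENNReal.continuous_ofReal.continuousAt.comp (ContinuousAt.neg ?_)
      exact ContinuousAt.log (by fun_prop) (by norm_num)
    simpa using this.tendsto.mono_left nhdsWithin_le_nhds
  obtain ⟨s, hsε, hs, hs'⟩ := ((hlog.eventually (gt_mem_nhds (pos_iff_ne_zero.2 hε))).and
    (Ioo_mem_nhdsGT (one_half_pos (α := ℝ)))).exists
  have hf : Measurable fun x : ℝ => s + (1 - 2 * s) * x := by fun_prop
  refine ⟨⟨ν.map _, Measure.isProbabilityMeasure_map hf.aemeasurable⟩, s, hs, ?_, ?_⟩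
  · refine (ae_map_iff hf.aemeasurable measurableSet_Icc).2 ?_
    filter_upwards [hν] with x hx
    constructor <;> nlinarith [hx.1, hx.2]
  · rw [add_comm]
    refine (mutualEnergy_map_le_of_mul_dist_le hf (a := 1 - 2 * s) (by linarith) ?_).trans
      (add_le_add_left hsε.le _)
    intro x y
    rw [Real.dist_eq, Real.dist_eq, add_sub_add_left_eq_sub, ← mul_sub, abs_mul,
      abs_of_pos (by linarith : 0 < 1 - 2 * s)]

theorem exists_absolutelyContinuous_mutualEnergy_le (ν : Measure ℝ) [IsProbabilityMeasure ν]
    (hν : ∀ᵐ x ∂ν, x ∈ Icc (0 : ℝ) 1) (hE : mutualEnergy posLogKernel ν ν ≠ ∞)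
    {ε : ℝ≥0} (hε : ε ≠ 0) :
    ∃ ν' : ProbabilityMeasure ℝ, (ν' : Measure ℝ) ≪ volume ∧
      (∀ᵐ x ∂(ν' : Measure ℝ), x ∈ Ioo (0 : ℝ) 1) ∧
      mutualEnergy (posLogKernel (X := ℝ)) ν' ν' ≤ mutualEnergy posLogKernel ν ν + ε := by
  have hε2 : (ε : ℝ≥0∞) / 2 ≠ 0 := (ENNReal.half_pos (ENNReal.coe_ne_zero.2 hε)).ne'
  obtain ⟨η, s, hs, hηs, hηE⟩ := exists_ae_mem_Icc_mutualEnergy_le ν hν hε2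
  let r : ℕ → ℝ := fun n => s / (n + 2)
  have hr : Tendsto r atTop (𝓝 0) :=
    tendsto_const_nhds.div_atTop (tendsto_atTop_add_const_right _ _ tendsto_natCast_atTop_atTop)
  have hpos : ∀ n, 0 < r n := fun n => by positivity
  obtain ⟨n, hn, hns⟩ := ((eventually_mutualEnergy_bind_uniformBallKernel_lt (η : Measure ℝ)
    (ne_top_of_le_ne_top (by finiteness) hηE) hε2 hpos hr).and
    (hr.eventually (gt_mem_nhds hs))).exists
  let κ : Kernel ℝ ℝ := uniformBallKernel measurable_id (measurable_const (a := r n))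
  have : IsMarkovKernel κ := isMarkovKernel_uniformBallKernel _ _ fun _ => hpos n
  refine ⟨⟨κ ∘ₘ (η : Measure ℝ), inferInstance⟩, ?_, ?_, ?_⟩
  · exact (Measure.AbsolutelyContinuous.comp_left _ (η := Kernel.const ℝ volume) <|
      ae_of_all _ fun x => uniformBall_absolutelyContinuous x (r n)).trans
        (by simp [Measure.AbsolutelyContinuous.rfl])
  · refine Measure.ae_comp_of_ae_ae measurableSet_Ioo ?_
    filter_upwards [hηs] with x hx
    filter_upwards [ae_mem_closedBall_uniformBall x (r n)] with y hy
    rw [Real.closedBall_eq_Icc] at hy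
    exact ⟨by linarith [hx.1, hy.1], by linarith [hx.2, hy.2]⟩
  · calc _ ≤ mutualEnergy posLogKernel (η : Measure ℝ) η + ε / 2 := hn.le
      _ ≤ mutualEnergy posLogKernel ν ν + ε / 2 + ε / 2 := by gcongr
      _ = mutualEnergy posLogKernel ν ν + ε := by rw [add_assoc, ENNReal.add_halves]

end Smoothing

section ContinuousDensity

variable {X : Type*} [MeasurableSpace X] {K : X → X → ℝ≥0∞} {Φ : Measure X} [IsFiniteMeasure Φ]

theorem coe_le_add_edist (s t : ℝ≥0) : (s : ℝ≥0∞) ≤ t + edist s t := by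
  rw [edist_nndist, ← ENNReal.coe_add]
  exact ENNReal.coe_le_coe.2 (NNReal.le_add_nndist s t)

theorem mutualEnergy_withDensity_self_le_add (hK : Measurable (Function.uncurry K))
    (hsymm : ∀ x y, K x y = K y x) {a g : X → ℝ≥0} (ha : Measurable a) {M : ℝ≥0}
    (haM : ∀ x, a x ≤ M) (hgM : ∀ x, g x ≤ M) :
    mutualEnergy K (Φ.withDensity fun x => g x) (Φ.withDensity fun x => g x) ≤
      mutualEnergy K (Φ.withDensity fun x => a x) (Φ.withDensity fun x => a x) +
        2 * M * mutualEnergy K Φ (Φ.withDensity fun x => edist (a x) (g x)) := by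
  have hsmul : ∀ f : X → ℝ≥0, (∀ x, f x ≤ M) →
      Φ.withDensity (fun x => f x) ≤ (M : ℝ≥0∞) • Φ := fun f hf => by
    rw [← withDensity_const]
    exact withDensity_mono (ae_of_all _ fun x => ENNReal.coe_le_coe.2 (hf x))
  refine mutualEnergy_self_le_of_le_add hK hsymm (hsmul a haM) (hsmul g hgM) ?_
  rw [← withDensity_add_left ha.coe_nnreal_ennreal]
  refine withDensity_mono (ae_of_all _ fun x => ?_)
  rw [Pi.add_apply, edist_comm]
  exact coe_le_add_edist (g x) (a x)

variable [TopologicalSpace X] [TopologicalSpace.MetrizableSpace X] [LocallyCompactSpace X]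
  [BorelSpace X] {F U : Set X}

theorem exists_continuous_lintegral_edist_le (Θ : Measure X) [IsFiniteMeasure Θ]
    (hF : IsCompact F) (hU : IsOpen U) (hFU : F ⊆ U) {a : X → ℝ≥0} (ha : Measurable a) {M : ℝ≥0}
    (haM : ∀ x, a x ≤ M) (haF : ∀ x ∉ F, a x = 0) {ε : ℝ≥0∞} (hε : ε ≠ 0) :
    ∃ g : X → ℝ≥0, Continuous g ∧ (∀ x, g x ≤ M) ∧ HasCompactSupport g ∧ tsupport g ⊆ U ∧
      ∫⁻ x, edist (a x) (g x) ∂Θ ≤ ε := by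
  have hint : Integrable (fun x => (a x : ℝ)) Θ :=
    Integrable.of_bound ha.coe_nnreal_real.aestronglyMeasurable M <|
      ae_of_all _ fun x => by simpa using haM x
  obtain ⟨h, hh, -⟩ := hint.exists_boundedContinuous_lintegral_sub_le hε
  obtain ⟨χ, hχ1, hχc, hχU, hχ⟩ := exists_continuousMap_one_of_isCompact_subset_isOpen hF hU hFU
  let g : X → ℝ≥0 := fun x => (χ x).toNNReal * min (h x).toNNReal M
  have hχg : tsupport g ⊆ tsupport χ :=
    (tsupport_mul_subset_left (f := fun x => (χ x).toNNReal)).trans <|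
      closure_mono fun x hx h0 => hx (by simp [h0])
  have hgc : Continuous g := by fun_prop
  refine ⟨g, by fun_prop, fun x => ?_, hχc.of_isClosed_subset (isClosed_tsupport g) hχg,
    hχg.trans hχU, (lintegral_mono fun x => ?_).trans hh⟩
  · exact (mul_le_of_le_one_left' (by simpa using (hχ x).2)).trans (min_le_right _ _)
  · have hclamp : |min (max (h x) 0) M - (a x : ℝ)| ≤ |(a x : ℝ) - h x| := by
      have ha0 : (0 : ℝ) ≤ a x := (a x).coe_nonneg
      have haM : (a x : ℝ) ≤ M := haM x
      grind
    rw [edist_comm, edist_dist, NNReal.dist_eq, Real.enorm_eq_ofReal_abs]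
    refine ENNReal.ofReal_le_ofReal (le_trans ?_ hclamp)
    simp only [g, NNReal.coe_mul, NNReal.coe_min, Real.coe_toNNReal', max_eq_left (hχ x).1]
    by_cases hx : x ∈ F
    · simp [hχ1 hx]
    · rw [haF x hx, NNReal.coe_zero, sub_zero, sub_zero, abs_mul, abs_of_nonneg (hχ x).1]
      exact mul_le_of_le_one_left (abs_nonneg _) (hχ x).2

theorem exists_continuous_withDensity_of_le (hK : Measurable (Function.uncurry K))
    (hsymm : ∀ x y, K x y = K y x) (hΦ : mutualEnergy K Φ Φ ≠ ∞)
    (hF : IsCompact F) (hU : IsOpen U) (hFU : F ⊆ U) {a : X → ℝ≥0} (ha : Measurable a) {M : ℝ≥0}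
    (haM : ∀ x, a x ≤ M) (haF : ∀ x ∉ F, a x = 0) {ε : ℝ≥0∞} (hε : ε ≠ 0) :
    ∃ g : X → ℝ≥0, Continuous g ∧ HasCompactSupport g ∧ tsupport g ⊆ U ∧
      ∫⁻ x, a x ∂Φ ≤ ∫⁻ x, g x ∂Φ + ε ∧
      mutualEnergy K (Φ.withDensity fun x => g x) (Φ.withDensity fun x => g x) ≤
        mutualEnergy K (Φ.withDensity fun x => a x) (Φ.withDensity fun x => a x) + ε := by
  have hV := measurable_lintegral_kernel hK (ν := Φ)
  have hV1 : Measurable fun y => 1 + ∫⁻ x, K x y ∂Φ := hV.const_add 1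
  have : IsFiniteMeasure (Φ.withDensity fun y => 1 + ∫⁻ x, K x y ∂Φ) :=
    isFiniteMeasure_withDensity <| by
      rw [lintegral_add_left measurable_const]
      simpa [mutualEnergy] using hΦ
  have hM : 1 + 2 * (M : ℝ≥0∞) ≠ ∞ := by finiteness
  -- The error is measured with the potential of `Φ` as weight, so it controls the energy as well.
  obtain ⟨g, hgc, hgM, hgs, hgU, hga⟩ :=
    exists_continuous_lintegral_edist_le (Φ.withDensity fun y => 1 + ∫⁻ x, K x y ∂Φ) hF hU hFU
      ha haM haF (ENNReal.div_ne_zero.2 ⟨hε, hM⟩)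
  have hd : Measurable fun x => edist (a x) (g x) := ha.edist hgc.measurable
  rw [lintegral_withDensity_eq_lintegral_mul _ hV1 hd] at hga
  refine ⟨g, hgc, hgs, hgU, ?_, (mutualEnergy_withDensity_self_le_add hK hsymm ha haM hgM).trans ?_⟩
  · calc ∫⁻ x, a x ∂Φ
        ≤ ∫⁻ x, g x + edist (a x) (g x) ∂Φ := lintegral_mono fun x => coe_le_add_edist (a x) (g x)
      _ = ∫⁻ x, g x ∂Φ + ∫⁻ x, edist (a x) (g x) ∂Φ := lintegral_add_right _ hd
      _ ≤ ∫⁻ x, g x ∂Φ + ε / (1 + 2 * M) := by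
        gcongr
        exact (lintegral_mono fun x => le_mul_of_one_le_left' le_self_add).trans hga
      _ ≤ ∫⁻ x, g x ∂Φ + ε := by
        gcongr
        exact ENNReal.div_le_of_le_mul (le_mul_of_one_le_right' le_self_add)
  · gcongr
    calc 2 * (M : ℝ≥0∞) * mutualEnergy K Φ (Φ.withDensity fun x => edist (a x) (g x))
        ≤ (1 + 2 * M) * (ε / (1 + 2 * M)) := by
          refine mul_le_mul' le_add_self (le_trans ?_ hga)
          rw [mutualEnergy, lintegral_withDensity_eq_lintegral_mul _ hd hV]
          refine lintegral_mono fun x => ?_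
          rw [Pi.mul_apply, Pi.mul_apply, mul_comm]
          gcongr
          exact le_add_self
      _ ≤ ε := ENNReal.mul_div_le

theorem exists_bounded_withDensity_le [SecondCountableTopology X] {ν : Measure X}
    [IsFiniteMeasure ν] (hν : ν ≪ Φ) (hU : IsOpen U) {r : ℝ≥0∞} (hr : r < ν U) :
    ∃ F ⊆ U, IsCompact F ∧ ∃ (a : X → ℝ≥0) (M : ℝ≥0), Measurable a ∧ (∀ x, a x ≤ M) ∧
      (∀ x ∉ F, a x = 0) ∧ r < ∫⁻ x, a x ∂Φ ∧ Φ.withDensity (fun x => a x) ≤ ν := by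
  obtain ⟨F, hFU, hF, hνF⟩ := hU.exists_lt_isCompact hr
  let ρ := ν.rnDeriv Φ
  have hρm : Measurable ρ := Measure.measurable_rnDeriv ν Φ
  have hρ : Φ.withDensity ρ = ν := Measure.withDensity_rnDeriv_eq ν Φ hν
  have hmass : ν F = ⨆ M : ℕ, ∫⁻ x in F, min (ρ x) M ∂Φ := by
    rw [← hρ, withDensity_apply _ hF.measurableSet,
      ← lintegral_iSup (fun M => hρm.min measurable_const) fun M N hMN x =>
        min_le_min le_rfl (by exact_mod_cast hMN)]
    refine lintegral_congr fun x => ?_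
    rw [← inf_iSup_eq, ENNReal.iSup_natCast, inf_top_eq]
  obtain ⟨M, hM⟩ := lt_iSup_iff.1 (hmass ▸ hνF)
  let a : X → ℝ≥0 := F.indicator fun x => (min (ρ x) M).toNNReal
  have ha : ∀ x, (a x : ℝ≥0∞) = F.indicator (fun x => min (ρ x) M) x := fun x => by
    by_cases hx : x ∈ F <;> simp [a, hx]
  refine ⟨F, hFU, hF, a, M, (hρm.min measurable_const).ennreal_toNNReal.indicator hF.measurableSet,
    fun x => ?_, fun x hx => indicator_of_notMem hx _, ?_, ?_⟩
  · rw [← ENNReal.coe_le_coe, ha]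
    exact indicator_le' (fun y _ => min_le_right _ _) (fun y _ => zero_le) x
  · simp_rw [ha]
    rwa [lintegral_indicator hF.measurableSet]
  · rw [← hρ]
    refine withDensity_mono (ae_of_all _ fun x => ?_)
    beta_reduce
    rw [ha]
    exact indicator_le' (fun y _ => min_le_left _ _) (fun y _ => zero_le) x

theorem exists_continuous_withDensity_of_absolutelyContinuous [SecondCountableTopology X]
    (hK : Measurable (Function.uncurry K)) (hsymm : ∀ x y, K x y = K y x)
    (hΦ : mutualEnergy K Φ Φ ≠ ∞) {ν : Measure X} [IsFiniteMeasure ν] (hν : ν ≪ Φ)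
    (hU : IsOpen U) {r : ℝ≥0∞} (hr : r < ν U) {ε : ℝ≥0∞} (hε : ε ≠ 0) :
    ∃ g : X → ℝ≥0, Continuous g ∧ HasCompactSupport g ∧ tsupport g ⊆ U ∧ r < ∫⁻ x, g x ∂Φ ∧
      mutualEnergy K (Φ.withDensity fun x => g x) (Φ.withDensity fun x => g x) ≤
        mutualEnergy K ν ν + ε := by
  obtain ⟨F, hFU, hF, a, M, ha, haM, haF, hra, haν⟩ := exists_bounded_withDensity_le hν hU hr
  obtain ⟨δ, hδ, hδra⟩ := ENNReal.lt_iff_exists_add_pos_lt.1 hra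
  obtain ⟨g, hgc, hgs, hgU, hga, hgE⟩ := exists_continuous_withDensity_of_le hK hsymm hΦ hF hU hFU
    ha haM haF (ε := min ε δ) (by simp [hε, hδ.ne'])
  refine ⟨g, hgc, hgs, hgU, ?_,
    hgE.trans (add_le_add (mutualEnergy_mono haν haν) (min_le_left _ _))⟩
  exact (ENNReal.add_lt_add_iff_right ENNReal.coe_ne_top).1 <|
    hδra.trans_le (hga.trans (by gcongr; exact min_le_right _ _))

end ContinuousDensity

section Discretization

variable {Ω X ι : Type*} [PseudoMetricSpace X] {c : Ω → X} {δ : ℝ} {i j : Ω}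

/-- The kernel `D` on the diagonal and `0` off it: its energy measures the concentration of a
measure on atoms. -/
def diagKernel (D : Ω → ℝ≥0∞) (i j : Ω) : ℝ≥0∞ := ({j} : Set Ω).indicator (fun _ => D j) i

/-- The logarithmic interactions, off the diagonal, of points `c i` at distance less than `δ`.
These are the terms of the sum in the log-average spacing condition. -/
def nearKernel (c : Ω → X) (δ : ℝ) (i j : Ω) : ℝ≥0∞ :=
  {i | i ≠ j ∧ dist (c i) (c j) < δ}.indicator (fun i => posLogKernel (c i) (c j)) i

theorem diagKernel_self (D : Ω → ℝ≥0∞) (i : Ω) : diagKernel D i i = D i := by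
  simp [diagKernel]

theorem diagKernel_of_ne (D : Ω → ℝ≥0∞) (h : i ≠ j) : diagKernel D i j = 0 := by
  simp [diagKernel, h]

theorem posLogKernel_le_min_add_nearKernel (hδ : 0 < δ) (h : i ≠ j) :
    posLogKernel (c i) (c j) ≤
      min (posLogKernel (c i) (c j)) (ENNReal.ofReal (-Real.log δ)) + nearKernel c δ i j := by
  rcases lt_or_ge (dist (c i) (c j)) δ with hlt | hge
  · have hmem : i ∈ {i | i ≠ j ∧ dist (c i) (c j) < δ} := ⟨h, hlt⟩
    rw [nearKernel, indicator_of_mem hmem]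
    exact le_add_self
  · rw [min_eq_left (posLogKernel_le_of_le_dist hδ hge)]
    exact le_self_add

theorem min_posLogKernel_le (hδ : 0 < δ) (i j : Ω) (N : ℝ≥0∞) :
    min (posLogKernel (c i) (c j)) N ≤
      ENNReal.ofReal (-Real.log δ) + (nearKernel c δ i j + diagKernel (fun _ => N) i j) := by
  rcases eq_or_ne i j with rfl | hij
  · rw [diagKernel_self]
    exact (min_le_right _ _).trans (le_add_self.trans le_add_self)
  · refine (min_le_left _ _).trans ((posLogKernel_le_min_add_nearKernel hδ hij).trans ?_)
    exact add_le_add (min_le_right _ _) le_self_add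

theorem mutualEnergy_uniformBall_le_of_separated {c r : Ω → ℝ} (hr : ∀ i, 0 < r i) (hδ : 0 < δ)
    {η : ℝ≥0} (hsep : i ≠ j → r i + r j ≤ (1 - Real.exp (-η)) * dist (c i) (c j)) :
    mutualEnergy posLogKernel (uniformBall (c i) (r i)) (uniformBall (c j) (r j)) ≤
      min (posLogKernel (c i) (c j)) (ENNReal.ofReal (-Real.log δ)) + (η + (nearKernel c δ i j +
        diagKernel (fun i => ENNReal.ofReal (-Real.log (2 * r i)) + 2) i j)) := by
  rcases eq_or_ne i j with rfl | hij
  · have := isProbabilityMeasure_uniformBall (a := c i) (hr i)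
    rw [diagKernel_self]
    exact (mutualEnergy_uniformBall_le (hr i) _ _).trans
      (le_add_self.trans (le_add_self.trans le_add_self))
  · have h := mutualEnergy_uniformBall_le_of_add_le (hr i) (hr j) (Real.exp_pos _) (hsep hij)
    rw [Real.log_exp, neg_neg, ENNReal.ofReal_coe_nnreal, add_comm] at h
    refine h.trans ?_
    rw [diagKernel_of_ne _ hij, add_zero, add_comm (η : ℝ≥0∞), ← add_assoc]
    gcongr
    exact posLogKernel_le_min_add_nearKernel hδ hij

variable [MeasurableSpace Ω]

theorem mutualEnergy_diagKernel [MeasurableSingletonClass Ω] (D : Ω → ℝ≥0∞) (ν μ : Measure Ω) :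
    mutualEnergy (diagKernel D) ν μ = ∫⁻ j, D j * ν {j} ∂μ :=
  lintegral_congr fun j => lintegral_indicator_const (measurableSet_singleton j) (D j)

variable [Countable Ω] [DiscreteMeasurableSpace Ω] {l : Filter ι} {ω : ι → ProbabilityMeasure Ω}

theorem mutualEnergy_ne_top_of_tendsto_map [MeasurableSpace X] [BorelSpace X]
    [SecondCountableTopology X] [l.NeBot] {Φ : ProbabilityMeasure X}
    (hω : Tendsto (fun n => (ω n).map (f := c) .of_discrete) l (𝓝 Φ)) (hδ : 0 < δ) {C : ℝ≥0}
    (hnear : ∀ᶠ n in l, mutualEnergy (nearKernel c δ) (ω n) (ω n) ≤ C)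
    (hdiag : Tendsto (fun n => ∫⁻ i, (ω n : Measure Ω) {i} ∂(ω n)) l (𝓝 0)) :
    mutualEnergy posLogKernel (Φ : Measure X) Φ ≠ ∞ := by
  refine ne_top_of_le_ne_top (b := ENNReal.ofReal (-Real.log δ) + (C + 0)) (by finiteness) ?_
  rw [mutualEnergy_eq_iSup_min measurable_posLogKernel]
  refine iSup_le fun N => ?_
  have hK : Continuous (Function.uncurry fun x y : X => min (posLogKernel x y) N) :=
    continuous_posLogKernel.min continuous_const
  have hlim := tendsto_mutualEnergy_of_continuous_of_le (M := N) hK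
    (fun x y => min_le_right _ _) hω
  have hdiagN : Tendsto (fun n => N * ∫⁻ i, (ω n : Measure Ω) {i} ∂(ω n)) l (𝓝 0) := by
    simpa using ENNReal.Tendsto.const_mul hdiag (Or.inr (ENNReal.natCast_ne_top N))
  refine le_of_tendsto_of_tendsto hlim ((hdiagN.const_add _).const_add _) ?_
  filter_upwards [hnear] with n hn
  rw [ProbabilityMeasure.toMeasure_map, mutualEnergy_map hK.measurable .of_discrete]
  calc mutualEnergy (fun i j => min (posLogKernel (c i) (c j)) N) (ω n : Measure Ω) (ω n)
      ≤ mutualEnergy (fun i j => ENNReal.ofReal (-Real.log δ) +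
          (nearKernel c δ i j + diagKernel (fun _ => N) i j)) (ω n : Measure Ω) (ω n) :=
        lintegral_mono fun j => lintegral_mono fun i => min_posLogKernel_le hδ i j N
    _ = ENNReal.ofReal (-Real.log δ) + (mutualEnergy (nearKernel c δ) (ω n) (ω n) +
          N * ∫⁻ i, (ω n : Measure Ω) {i} ∂(ω n)) := by
        rw [mutualEnergy_kernel_add .of_discrete, mutualEnergy_kernel_add .of_discrete,
          mutualEnergy_kernel_const, mutualEnergy_diagKernel, lintegral_const_mul _ .of_discrete]
        simp
    _ ≤ _ := by gcongr

/-- The discretization of the density `g` by a measure `ω` on a set of indices: the sum over `i` of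
the uniform distributions on the balls of center `c i` and radius `r i`, with the weights
`g (c i) * ω {i}`. -/
def discretization (c r : Ω → ℝ) (g : ℝ → ℝ≥0) (ω : Measure Ω) : Measure ℝ :=
  (ω.withDensity fun i => g (c i)).bind
    (uniformBallKernel (a := c) (r := r) .of_discrete .of_discrete)

variable {c r : Ω → ℝ} {g : ℝ → ℝ≥0}

theorem mutualEnergy_discretization_le (hr : ∀ i, 0 < r i) (hδ : 0 < δ) (hg : Measurable g)
    {B η : ℝ≥0} (hB : ∀ x, g x ≤ B) (ω : Measure Ω) [IsProbabilityMeasure ω]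
    (hsep : ∀ᵐ j ∂ω, ∀ᵐ i ∂ω, i ≠ j → r i + r j ≤ (1 - Real.exp (-η)) * dist (c i) (c j)) :
    mutualEnergy posLogKernel (discretization c r g ω) (discretization c r g ω) ≤
      mutualEnergy (fun x y => g x * g y * min (posLogKernel x y) (ENNReal.ofReal (-Real.log δ)))
        (ω.map c) (ω.map c) + B * (B * (η + (mutualEnergy (nearKernel c δ) ω ω +
          ∫⁻ i, (ENNReal.ofReal (-Real.log (2 * r i)) + 2) * ω {i} ∂ω))) := by
  have := isMarkovKernel_uniformBallKernel (a := c) (r := r) .of_discrete .of_discrete hr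
  let D : Ω → ℝ≥0∞ := fun i => ENNReal.ofReal (-Real.log (2 * r i)) + 2
  let T : ℝ → ℝ → ℝ≥0∞ := fun x y => min (posLogKernel x y) (ENNReal.ofReal (-Real.log δ))
  let L : Ω → Ω → ℝ≥0∞ := fun i j => η + (nearKernel c δ i j + diagKernel D i j)
  have hT : Measurable (Function.uncurry T) := measurable_posLogKernel.min measurable_const
  have hgT : Measurable (Function.uncurry fun x y => g x * g y * T x y) :=
    ((hg.coe_nnreal_ennreal.comp measurable_fst).mul
      (hg.coe_nnreal_ennreal.comp measurable_snd)).mul hT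
  have hac := withDensity_absolutelyContinuous ω fun i => (g (c i) : ℝ≥0∞)
  have hle : ω.withDensity (fun i => (g (c i) : ℝ≥0∞)) ≤ (B : ℝ≥0∞) • ω := by
    rw [← withDensity_const]
    exact withDensity_mono (ae_of_all _ fun i => ENNReal.coe_le_coe.2 (hB (c i)))
  rw [discretization, mutualEnergy_bind measurable_posLogKernel]
  calc mutualEnergy (fun i j => mutualEnergy posLogKernel (uniformBall (c i) (r i))
          (uniformBall (c j) (r j)))
        (ω.withDensity fun i => g (c i)) (ω.withDensity fun i => g (c i))
      ≤ mutualEnergy (fun i j => T (c i) (c j) + L i j)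
          (ω.withDensity fun i => g (c i)) (ω.withDensity fun i => g (c i)) :=
        mutualEnergy_mono_kernel_ae <| hac.ae_le <| hsep.mono fun j hj => hac.ae_le <|
          hj.mono fun i hij => mutualEnergy_uniformBall_le_of_separated hr hδ hij
    _ = mutualEnergy (fun x y => g x * g y * T x y) (ω.map c) (ω.map c) +
          mutualEnergy L (ω.withDensity fun i => g (c i)) (ω.withDensity fun i => g (c i)) := by
        rw [mutualEnergy_kernel_add .of_discrete,
          mutualEnergy_withDensity .of_discrete .of_discrete, mutualEnergy_map hgT .of_discrete]
    _ ≤ _ + mutualEnergy L ((B : ℝ≥0∞) • ω) ((B : ℝ≥0∞) • ω) :=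
        add_le_add_right (mutualEnergy_mono hle hle) _
    _ = _ := by
        rw [mutualEnergy_smul_right, mutualEnergy_smul_left .of_discrete,
          mutualEnergy_kernel_add .of_discrete, mutualEnergy_kernel_add .of_discrete,
          mutualEnergy_kernel_const, mutualEnergy_diagKernel, measure_univ, mul_one, mul_one]

end Discretization

section DiscretizationLimit

variable {Ω ι : Type*} [MeasurableSpace Ω] [DiscreteMeasurableSpace Ω]
  {l : Filter ι} {ω : ι → ProbabilityMeasure Ω} {c r : Ω → ℝ} {g : ℝ → ℝ≥0}
  {Φ : ProbabilityMeasure ℝ}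

theorem discretization_univ (hr : ∀ i, 0 < r i) (ω : Measure Ω) :
    discretization c r g ω univ = ∫⁻ i, g (c i) ∂ω := by
  have := isMarkovKernel_uniformBallKernel (a := c) (r := r) .of_discrete .of_discrete hr
  rw [discretization, Measure.bind_apply .univ (Kernel.aemeasurable _)]
  simp

theorem isFiniteMeasure_discretization (hr : ∀ i, 0 < r i) {B : ℝ≥0} (hB : ∀ x, g x ≤ B)
    (ω : Measure Ω) [IsFiniteMeasure ω] : IsFiniteMeasure (discretization c r g ω) where
  measure_univ_lt_top := by
    rw [discretization_univ hr]
    exact (lintegral_mono fun i => ENNReal.coe_le_coe.2 (hB (c i))).trans_lt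
      (by simp [ENNReal.mul_lt_top])

theorem tendsto_discretization_univ (hr : ∀ i, 0 < r i)
    (hω : Tendsto (fun n => (ω n).map (f := c) .of_discrete) l (𝓝 Φ)) (hg : Continuous g)
    {B : ℝ≥0} (hB : ∀ x, g x ≤ B) :
    Tendsto (fun n => discretization c r g (ω n) univ) l (𝓝 (∫⁻ x, g x ∂Φ)) := by
  refine (tendsto_lintegral_of_continuous_of_le (M := B) (ENNReal.continuous_coe.comp hg)
    (fun x => ENNReal.coe_le_coe.2 (hB x)) hω).congr fun n => ?_
  rw [ProbabilityMeasure.toMeasure_map, discretization_univ hr,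
    lintegral_map (ENNReal.continuous_coe.comp hg).measurable .of_discrete]
  rfl

theorem discretization_absolutelyContinuous (ω : Measure Ω) :
    discretization c r g ω ≪ volume :=
  (Measure.AbsolutelyContinuous.comp_left _ (η := Kernel.const Ω volume) <|
    ae_of_all _ fun i => uniformBall_absolutelyContinuous (c i) (r i)).trans <| by
      rw [Measure.const_comp]
      exact Measure.smul_absolutelyContinuous

theorem ae_mem_discretization {A : Set ℝ} (hA : MeasurableSet A) {ω : Measure Ω}
    (h : ∀ᵐ i ∂ω, g (c i) ≠ 0 → Metric.closedBall (c i) (r i) ⊆ A) :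
    ∀ᵐ x ∂(discretization c r g ω), x ∈ A := by
  refine Measure.ae_comp_of_ae_ae hA ((ae_withDensity_iff .of_discrete).2 ?_)
  filter_upwards [h] with i hi h0
  exact (ae_mem_closedBall_uniformBall _ _).mono (hi (by simpa using h0))

theorem exists_isCompact_ae_mem_discretization {ω : Measure Ω} {s : Set Ω} (hs : s.Finite)
    (hωs : ∀ᵐ i ∂ω, i ∈ s) {ρ : ℝ} (hrρ : ∀ᵐ i ∂ω, r i ≤ ρ) {U G : Set ℝ}
    (hgU : Metric.cthickening ρ (tsupport g) ⊆ U)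
    (hG : ∀ᵐ i ∂ω, Metric.closedBall (c i) (r i) ⊆ G) :
    ∃ F : Set ℝ, IsCompact F ∧ F ⊆ U ∩ G ∧ ∀ᵐ x ∂(discretization c r g ω), x ∈ F := by
  let t : Set Ω := {i ∈ s | Metric.closedBall (c i) (r i) ⊆ U ∩ G}
  have ht : IsCompact (⋃ i ∈ t, Metric.closedBall (c i) (r i)) :=
    (hs.subset fun _ hi => hi.1).isCompact_biUnion fun i _ => isCompact_closedBall _ _
  refine ⟨_, ht, iUnion₂_subset fun i hi => hi.2, ae_mem_discretization ht.measurableSet ?_⟩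
  filter_upwards [hωs, hrρ, hG] with i his hiρ hiG hgi
  have hiU : Metric.closedBall (c i) (r i) ⊆ U := fun x hx => hgU <|
    Metric.mem_cthickening_of_dist_le x (c i) ρ _ (subset_tsupport g hgi) (hx.trans hiρ)
  exact subset_biUnion_of_mem (u := fun i => Metric.closedBall (c i) (r i))
    (show i ∈ t from ⟨his, subset_inter hiU hiG⟩)

/-- The balls of center `c i` and radius `r i` are well spaced along the index distributions `ω n`:
the energies of pairs of nearby centers, of single balls and the overlaps of distinct balls are all
asymptotically negligible. -/
structure WellSpaced (ω : ι → ProbabilityMeasure Ω) (l : Filter ι) (c r : Ω → ℝ) : Prop where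
  near : ∀ ε : ℝ≥0, 0 < ε → ∃ δ : ℝ, 0 < δ ∧
    ∀ᶠ n in l, mutualEnergy (nearKernel c δ) (ω n) (ω n) ≤ ε
  separated : ∀ θ : ℝ, 0 < θ → ∀ᶠ n in l, ∀ᵐ j ∂(ω n : Measure Ω), ∀ᵐ i ∂(ω n : Measure Ω),
    i ≠ j → r i + r j ≤ θ * dist (c i) (c j)
  diag : Tendsto (fun n => ∫⁻ i, (ENNReal.ofReal (-Real.log (2 * r i)) + 2) *
    (ω n : Measure Ω) {i} ∂(ω n)) l (𝓝 0)

variable [Countable Ω]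

theorem WellSpaced.mutualEnergy_ne_top [l.NeBot] (h : WellSpaced ω l c r)
    (hω : Tendsto (fun n => (ω n).map (f := c) .of_discrete) l (𝓝 Φ)) :
    mutualEnergy posLogKernel (Φ : Measure ℝ) Φ ≠ ∞ := by
  obtain ⟨δ, hδ, hnear⟩ := h.near 1 one_pos
  refine mutualEnergy_ne_top_of_tendsto_map hω hδ hnear ?_
  refine tendsto_of_tendsto_of_tendsto_of_le_of_le tendsto_const_nhds h.diag (fun _ => zero_le)
    fun n => lintegral_mono fun i => le_mul_of_one_le_left' ?_
  exact one_le_two.trans le_add_self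

theorem WellSpaced.eventually_mutualEnergy_discretization_le (h : WellSpaced ω l c r)
    (hω : Tendsto (fun n => (ω n).map (f := c) .of_discrete) l (𝓝 Φ)) (hr : ∀ i, 0 < r i)
    (hg : Continuous g) {B : ℝ≥0} (hB : ∀ x, g x ≤ B) {ε : ℝ≥0} (hε : 0 < ε) :
    ∀ᶠ n in l,
      mutualEnergy posLogKernel (discretization c r g (ω n)) (discretization c r g (ω n)) ≤
        mutualEnergy posLogKernel ((Φ : Measure ℝ).withDensity fun x => g x)
          ((Φ : Measure ℝ).withDensity fun x => g x) + ε := by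
  obtain ⟨η, hη, hηε⟩ : ∃ η : ℝ≥0, 0 < η ∧ η + B * (B * (η + (η + η))) ≤ ε := by
    refine ⟨ε / (1 + 3 * (B * B)), by positivity, le_of_eq ?_⟩
    field_simp
    ring
  obtain ⟨δ, hδ, hnear⟩ := h.near η hη
  have hlim := eventually_mutualEnergy_mul_min_le continuous_posLogKernel hω hg hB
    (ENNReal.ofReal_ne_top (r := -Real.log δ)) hη.ne'
  have hexp : 0 < 1 - Real.exp (-η) := by simpa using hη
  filter_upwards [hlim, hnear, h.separated _ hexp,
    h.diag.eventually_le_const (ENNReal.coe_pos.2 hη)] with n hTn hnearn hsep hdiag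
  refine ((mutualEnergy_discretization_le hr hδ hg.measurable hB _ hsep).trans
    (add_le_add hTn (mul_le_mul_right (mul_le_mul_right
      (add_le_add le_rfl (add_le_add hnearn hdiag)) _) _))).trans ?_
  rw [add_assoc]
  exact add_le_add le_rfl (by exact_mod_cast hηε)

theorem exists_inv_one_sub_mul_le {E ε : ℝ≥0∞} (hE : E ≠ ∞) (hε : ε ≠ 0) :
    ∃ η : ℝ≥0, 0 < η ∧ (1 - η : ℝ≥0∞)⁻¹ * ((1 - η : ℝ≥0∞)⁻¹ * (E + (η + η))) ≤ E + ε := by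
  have hη : Tendsto (fun η : ℝ≥0 => (η : ℝ≥0∞)) (𝓝[>] 0) (𝓝 0) :=
    (ENNReal.continuous_coe.tendsto 0).mono_left nhdsWithin_le_nhds
  have hinv : Tendsto (fun η : ℝ≥0 => (1 - η : ℝ≥0∞)⁻¹) (𝓝[>] 0) (𝓝 1) := by
    simpa using (ENNReal.Tendsto.sub tendsto_const_nhds hη (Or.inl ENNReal.one_ne_top)).inv
  have hadd : Tendsto (fun η : ℝ≥0 => E + (η + η)) (𝓝[>] 0) (𝓝 E) := by
    simpa using (hη.add hη).const_add E
  have hlim : Tendsto (fun η : ℝ≥0 => (1 - η : ℝ≥0∞)⁻¹ * ((1 - η : ℝ≥0∞)⁻¹ * (E + (η + η))))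
      (𝓝[>] 0) (𝓝 E) := by
    simpa using ENNReal.Tendsto.mul hinv (Or.inl one_ne_zero)
      (ENNReal.Tendsto.mul hinv (Or.inl one_ne_zero) hadd (Or.inr ENNReal.one_ne_top))
      (Or.inr ENNReal.one_ne_top)
  obtain ⟨η, hle, hpos⟩ := ((hlim.eventually_le_const (ENNReal.lt_add_right hE hε)).and
    eventually_mem_nhdsWithin).exists
  exact ⟨η, hpos, hle⟩

theorem mutualEnergy_cond_univ_le {X : Type*} [MeasurableSpace X] {K : X → X → ℝ≥0∞}
    (hK : Measurable (Function.uncurry K)) {μ : Measure X} [SFinite μ] {a : ℝ≥0∞}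
    (ha : a ≤ μ univ) :
    mutualEnergy K (μ[|univ]) (μ[|univ]) ≤ a⁻¹ * (a⁻¹ * mutualEnergy K μ μ) := by
  rw [ProbabilityTheory.cond, Measure.restrict_univ, mutualEnergy_smul_right,
    mutualEnergy_smul_left hK]
  gcongr

theorem WellSpaced.exists_mutualEnergy_le [l.NeBot] (h : WellSpaced ω l c r)
    (hω : Tendsto (fun n => (ω n).map (f := c) .of_discrete) l (𝓝 Φ)) (hr : ∀ i, 0 < r i)
    (hfin : ∀ᶠ n in l, ∃ s : Set Ω, s.Finite ∧ ∀ᵐ i ∂(ω n : Measure Ω), i ∈ s)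
    (hr0 : ∀ ρ : ℝ, 0 < ρ → ∀ᶠ n in l, ∀ᵐ i ∂(ω n : Measure Ω), r i ≤ ρ) {G : Set ℝ}
    (hG : ∀ᶠ n in l, ∀ᵐ i ∂(ω n : Measure Ω), Metric.closedBall (c i) (r i) ⊆ G)
    {ν : Measure ℝ} [IsProbabilityMeasure ν] (hν : ν ≪ Φ) {U : Set ℝ} (hU : IsOpen U)
    (hνU : ∀ᵐ x ∂ν, x ∈ U) (hE : mutualEnergy posLogKernel ν ν ≠ ∞) {ε : ℝ≥0∞} (hε : ε ≠ 0) :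
    ∃ (ν' : ProbabilityMeasure ℝ) (F : Set ℝ), (ν' : Measure ℝ) ≪ volume ∧ IsCompact F ∧
      F ⊆ U ∩ G ∧ (∀ᵐ x ∂(ν' : Measure ℝ), x ∈ F) ∧
      mutualEnergy (posLogKernel (X := ℝ)) ν' ν' ≤ mutualEnergy posLogKernel ν ν + ε := by
  obtain ⟨η, hη, hηε⟩ := exists_inv_one_sub_mul_le hE hε
  have hmassν : 1 - (η : ℝ≥0∞) < ν U := by
    rw [(mem_ae_iff_prob_eq_one hU.measurableSet).1 hνU]
    exact ENNReal.sub_lt_self ENNReal.one_ne_top one_ne_zero (ENNReal.coe_ne_zero.2 hη.ne')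
  obtain ⟨g, hg, hgc, hgU, hgmass, hgE⟩ := exists_continuous_withDensity_of_absolutelyContinuous
    measurable_posLogKernel posLogKernel_comm (h.mutualEnergy_ne_top hω) hν hU hmassν
    (ENNReal.coe_ne_zero.2 hη.ne')
  obtain ⟨B, hB⟩ := hg.bddAbove_range_of_hasCompactSupport hgc
  rw [mem_upperBounds, forall_mem_range] at hB
  obtain ⟨ρ, hρ, hρU⟩ := hgc.exists_cthickening_subset_open hU hgU
  obtain ⟨n, hEn, hmass, ⟨s, hs, hωs⟩, hrρ, hGn⟩ :=
    ((h.eventually_mutualEnergy_discretization_le hω hr hg hB hη).and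
      (((tendsto_discretization_univ hr hω hg hB).eventually_const_lt hgmass).and
        (hfin.and ((hr0 ρ hρ).and hG)))).exists
  obtain ⟨F, hF, hFG, hmemF⟩ := exists_isCompact_ae_mem_discretization hs hωs hrρ hρU hGn
  have := isFiniteMeasure_discretization (c := c) hr hB (ω n : Measure Ω)
  have := cond_isProbabilityMeasure (μ := discretization c r g (ω n)) (s := univ)
    (pos_of_gt hmass).ne'
  refine ⟨⟨(discretization c r g (ω n))[|univ], this⟩, F,
    cond_absolutelyContinuous.trans (discretization_absolutelyContinuous _), hF, hFG,
    cond_absolutelyContinuous.ae_le hmemF, ?_⟩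
  refine (mutualEnergy_cond_univ_le measurable_posLogKernel hmass.le).trans (le_trans ?_ hηε)
  gcongr
  exact hEn.trans ((add_le_add_left hgE _).trans_eq (add_assoc _ _ _))

end DiscretizationLimit

section UniformOn

variable {Ω : Type*} [MeasurableSpace Ω] [MeasurableSingletonClass Ω] {s t : Finset Ω}
  {D : Ω → ℝ≥0∞}

theorem ae_mem_uniformOn (s : Finset Ω) : ∀ᵐ i ∂(uniformOn (s : Set Ω)), i ∈ s :=
  ae_cond_mem s.measurableSet

theorem lintegral_uniformOn (s : Finset Ω) (f : Ω → ℝ≥0∞) :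
    ∫⁻ i, f i ∂(uniformOn (s : Set Ω)) = (∑ i ∈ s, f i) / s.card := by
  rw [uniformOn, ProbabilityTheory.cond, lintegral_smul_measure, lintegral_finset,
    Measure.count_apply_finset, smul_eq_mul, ENNReal.div_eq_inv_mul]
  simp

theorem mutualEnergy_uniformOn (K : Ω → Ω → ℝ≥0∞) (s t : Finset Ω) :
    mutualEnergy K (uniformOn (s : Set Ω)) (uniformOn (t : Set Ω)) =
      (∑ p ∈ s ×ˢ t, K p.1 p.2) / (s ×ˢ t).card := by
  simp only [mutualEnergy, lintegral_uniformOn, Finset.sum_product_right, Finset.card_product,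
    Nat.cast_mul, div_eq_mul_inv, Finset.sum_mul, mul_assoc]
  rw [ENNReal.mul_inv (by simp) (by simp)]

theorem uniformOn_singleton_le (s : Finset Ω) (i : Ω) :
    uniformOn (s : Set Ω) {i} ≤ (s.card : ℝ≥0∞)⁻¹ := by
  rw [uniformOn, cond_apply s.measurableSet, Measure.count_apply_finset]
  refine mul_le_of_le_one_right' ?_
  exact (measure_mono inter_subset_right).trans_eq (Measure.count_singleton i)

theorem mutualEnergy_diagKernel_uniformOn_self_le {C : ℝ≥0∞} (h : ∀ i ∈ s, D i ≤ C * s.card) :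
    mutualEnergy (diagKernel D) (uniformOn (s : Set Ω)) (uniformOn (s : Set Ω)) ≤ C := by
  rw [mutualEnergy_diagKernel]
  calc ∫⁻ i, D i * uniformOn (s : Set Ω) {i} ∂(uniformOn (s : Set Ω))
      ≤ ∫⁻ _, C ∂(uniformOn (s : Set Ω)) := by
        refine lintegral_mono_ae ((ae_mem_uniformOn s).mono fun i hi => ?_)
        refine (mul_le_mul' (h i hi) (uniformOn_singleton_le s i)).trans ?_
        rw [mul_assoc]
        exact mul_le_of_le_one_right' (ENNReal.mul_inv_le_one _)
    _ ≤ C := by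
        rw [lintegral_const]
        exact mul_le_of_le_one_right' prob_le_one

theorem mutualEnergy_diagKernel_uniformOn_of_disjoint (h : Disjoint s t) :
    mutualEnergy (diagKernel D) (uniformOn (s : Set Ω)) (uniformOn (t : Set Ω)) = 0 := by
  rw [mutualEnergy_diagKernel, lintegral_uniformOn]
  refine ENNReal.div_eq_zero_iff.2 (Or.inl (Finset.sum_eq_zero fun i hi => ?_))
  have hi : (s : Set Ω) ∩ {i} = ∅ := by simpa using Finset.disjoint_right.1 h hi
  rw [uniformOn, cond_apply s.measurableSet, hi, measure_empty, mul_zero, mul_zero]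

end UniformOn

section Multiscale

variable {n q : ℕ} {c : ℕ → ℝ}

theorem card_block (n : ℕ) : (block n).card = n := by
  simp [block, two_mul]

theorem disjoint_block_pow_mul (n : ℕ) {s t : ℕ} (hst : s ≠ t) :
    Disjoint (block (2 ^ s * n)) (block (2 ^ t * n)) := by
  wlog hlt : s < t generalizing s t
  · exact (this hst.symm (hst.lt_or_gt.resolve_left hlt)).symm
  refine Finset.Ico_disjoint_Ico_consecutive _ _ _ |>.mono_right (Finset.Ico_subset_Ico_left ?_)
  rw [← mul_assoc, ← pow_succ']
  exact Nat.mul_le_mul_right n (Nat.pow_le_pow_right two_pos hlt)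

/-- The Markov kernel sending a scale `s` to the uniform distribution on the block of
`2 ^ s * n`. -/
def blockKernel (n : ℕ) : Kernel ℕ ℕ :=
  Kernel.ofFunOfCountable fun s => uniformOn (block (2 ^ s * n) : Set ℕ)

instance isMarkovKernel_blockKernel [NeZero n] : IsMarkovKernel (blockKernel n) where
  isProbabilityMeasure s := isProbabilityMeasure_uniformOn (Finset.finite_toSet _) <| by
    rw [Finset.coe_nonempty, ← Finset.card_pos, card_block]
    exact Nat.mul_pos (by positivity) (NeZero.pos n)

/-- The distribution of a random index drawn in two steps: a scale `s ≤ q` uniformly at random,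
then an index uniformly at random in the block of `2 ^ s * n`. -/
def multiscale (n q : ℕ) : Measure ℕ :=
  (uniformOn (Finset.range (q + 1) : Set ℕ)).bind (blockKernel n)

instance isProbabilityMeasure_uniformOn_range_succ :
    IsProbabilityMeasure (uniformOn (Finset.range (q + 1) : Set ℕ)) :=
  isProbabilityMeasure_uniformOn (Finset.finite_toSet _) (by simp)

instance isProbabilityMeasure_multiscale [NeZero n] : IsProbabilityMeasure (multiscale n q) :=
  inferInstanceAs (IsProbabilityMeasure (Measure.bind _ _))

theorem ae_mem_multiBlock_multiscale (n q : ℕ) :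
    ∀ᵐ i ∂(multiscale n q), i ∈ multiBlock n q := by
  refine Measure.ae_comp_of_ae_ae .of_discrete ?_
  filter_upwards [ae_mem_uniformOn (Finset.range (q + 1))] with s hs
  exact (ae_mem_uniformOn _).mono fun i hi => Finset.mem_biUnion.2 ⟨s, hs, hi⟩

theorem le_of_mem_multiBlock {i : ℕ} (hi : i ∈ multiBlock n q) : n ≤ i := by
  obtain ⟨s, -, hi⟩ := Finset.mem_biUnion.1 hi
  exact (Nat.le_mul_of_pos_left n (by positivity)).trans (Finset.mem_Ico.1 hi).1

theorem mutualEnergy_multiscale_le [NeZero n] {K L : ℕ → ℕ → ℝ≥0∞}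
    (h : ∀ s ≤ q, ∀ t ≤ q, mutualEnergy K (uniformOn (block (2 ^ s * n) : Set ℕ))
      (uniformOn (block (2 ^ t * n) : Set ℕ)) ≤ L s t) :
    mutualEnergy K (multiscale n q) (multiscale n q) ≤
      mutualEnergy L (uniformOn (Finset.range (q + 1) : Set ℕ))
        (uniformOn (Finset.range (q + 1) : Set ℕ)) := by
  rw [multiscale, mutualEnergy_bind .of_discrete]
  refine mutualEnergy_mono_kernel_ae ?_
  filter_upwards [ae_mem_uniformOn (Finset.range (q + 1))] with t ht
  filter_upwards [ae_mem_uniformOn (Finset.range (q + 1))] with s hs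
  exact h s (Finset.mem_range_succ_iff.1 hs) t (Finset.mem_range_succ_iff.1 ht)

theorem mutualEnergy_diagKernel_multiscale_le [NeZero n] {D : ℕ → ℝ≥0∞} {C : ℝ≥0∞}
    (h : ∀ i, n ≤ i → D i ≤ C * i) :
    mutualEnergy (diagKernel D) (multiscale n q) (multiscale n q) ≤ 2 * C / (q + 1) := by
  refine (mutualEnergy_multiscale_le (L := diagKernel fun _ => 2 * C) fun s _ t _ => ?_).trans ?_
  · rcases eq_or_ne s t with rfl | hst
    · rw [diagKernel_self]
      refine mutualEnergy_diagKernel_uniformOn_self_le fun i hi => ?_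
      obtain ⟨hni, hin⟩ := Finset.mem_Ico.1 hi
      refine (h i ((Nat.le_mul_of_pos_left n (by positivity)).trans hni)).trans ?_
      rw [card_block, mul_comm 2, mul_assoc]
      gcongr
      exact_mod_cast hin.le
    · rw [mutualEnergy_diagKernel_uniformOn_of_disjoint (disjoint_block_pow_mul n hst)]
      exact zero_le
  · refine mutualEnergy_diagKernel_uniformOn_self_le fun _ _ => ?_
    rw [Finset.card_range, Nat.cast_add_one, ENNReal.div_mul_cancel (by simp) (by finiteness)]

theorem tendsto_lintegral_multiscale {f : ℕ → ℝ≥0∞} {a : ℝ≥0∞}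
    (h : Tendsto (fun n => ∫⁻ i, f i ∂(uniformOn (block n : Set ℕ))) atTop (𝓝 a)) (q : ℕ → ℕ) :
    Tendsto (fun n => ∫⁻ i, f i ∂(multiscale n (q n))) atTop (𝓝 a) := by
  have hmul : ∀ n s : ℕ, n ≤ 2 ^ s * n := fun n s => Nat.le_mul_of_pos_left n (by positivity)
  have hbind : ∀ n, ∫⁻ i, f i ∂(multiscale n (q n)) =
      ∫⁻ s, ∫⁻ i, f i ∂(uniformOn (block (2 ^ s * n) : Set ℕ))
        ∂(uniformOn (Finset.range (q n + 1) : Set ℕ)) := fun n =>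
    Measure.lintegral_bind (Kernel.aemeasurable _) (by fun_prop)
  simp only [hbind]
  refine tendsto_order.2 ⟨fun b hb => ?_, fun b hb => ?_⟩
  · obtain ⟨d, hbd, hda⟩ := exists_between hb
    filter_upwards [eventually_forall_ge_atTop.2 (h.eventually_const_le hda)] with n hn
    have hle := lintegral_mono (μ := uniformOn (Finset.range (q n + 1) : Set ℕ))
      fun s => hn _ (hmul n s)
    rw [lintegral_const, measure_univ, mul_one] at hle
    exact hbd.trans_le hle
  · obtain ⟨d, had, hdb⟩ := exists_between hb
    filter_upwards [eventually_forall_ge_atTop.2 (h.eventually_le_const had)] with n hn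
    have hle := lintegral_mono (μ := uniformOn (Finset.range (q n + 1) : Set ℕ))
      fun s => hn _ (hmul n s)
    rw [lintegral_const, measure_univ, mul_one] at hle
    exact hle.trans_lt hdb

/-- The index distributions used to discretize measures. The shift `n + 1` excludes the empty block
of `0`. -/
def multiscaleSeq (q : ℕ → ℕ) (n : ℕ) : ProbabilityMeasure ℕ :=
  ⟨multiscale (n + 1) (q (n + 1)), inferInstance⟩

end Multiscale

section Centers

variable {c l : ℕ → ℝ} {φ : ℝ → ℝ} {q : ℕ → ℕ}

/-- The distribution of density `φ` on the unit interval. -/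
def densityMeasure (φ : ℝ → ℝ) : Measure ℝ :=
  (volume.restrict (Icc 0 1)).withDensity fun x => ENNReal.ofReal (φ x)

theorem Distributed.volume_absolutelyContinuous_densityMeasure (h : Distributed c φ) :
    volume.restrict (Icc 0 1) ≪ densityMeasure φ := by
  refine withDensity_absolutelyContinuous' h.1.aestronglyMeasurable.aemeasurable.ennreal_ofReal ?_
  filter_upwards [h.2.1] with x hx
  simpa using hx

theorem Distributed.tendsto_lintegral_uniformOn (h : Distributed c φ) {f : ℝ → ℝ≥0}
    (hf : Continuous f) :
    Tendsto (fun n => ∫⁻ i, f (c i) ∂(uniformOn (block n : Set ℕ))) atTop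
      (𝓝 (∫⁻ x, f x ∂(densityMeasure φ))) := by
  have hlim := ENNReal.tendsto_ofReal (h.2.2 (fun x => f x) (by fun_prop))
  have hint : ENNReal.ofReal (∫ x in Icc (0 : ℝ) 1, f x * φ x) =
      ∫⁻ x, f x ∂(densityMeasure φ) := by
    have hprod : IntegrableOn (fun x => (f x : ℝ) * φ x) (Icc 0 1) :=
      h.1.continuousOn_mul (by fun_prop) isCompact_Icc
    rw [ofReal_integral_eq_lintegral_ofReal hprod
        (h.2.1.mono fun x hx => mul_nonneg (f x).2 hx.le),
      densityMeasure, lintegral_withDensity_eq_lintegral_mul₀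
        h.1.aestronglyMeasurable.aemeasurable.ennreal_ofReal
        hf.measurable.coe_nnreal_ennreal.aemeasurable]
    refine lintegral_congr fun x => ?_
    rw [ENNReal.ofReal_mul (f x).coe_nonneg, ENNReal.ofReal_coe_nnreal, Pi.mul_apply, mul_comm]
  rw [hint] at hlim
  refine hlim.congr' ?_
  filter_upwards [eventually_gt_atTop 0] with n hn
  rw [lintegral_uniformOn, ENNReal.ofReal_div_of_pos (by simpa [card_block]),
    ENNReal.ofReal_natCast, ENNReal.ofReal_sum_of_nonneg fun _ _ => NNReal.coe_nonneg _]
  simp only [ENNReal.ofReal_coe_nnreal]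

theorem Distributed.isProbabilityMeasure_densityMeasure (h : Distributed c φ) :
    IsProbabilityMeasure (densityMeasure φ) where
  measure_univ := by
    have hlim := h.tendsto_lintegral_uniformOn (f := fun _ => 1) continuous_const
    simp only [ENNReal.coe_one, lintegral_one] at hlim
    refine tendsto_nhds_unique hlim (tendsto_const_nhds.congr' ?_)
    filter_upwards [eventually_gt_atTop 0] with n hn
    have := isProbabilityMeasure_uniformOn (Finset.finite_toSet (block n)) <| by
      rwa [Finset.coe_nonempty, ← Finset.card_pos, card_block]
    exact measure_univ.symm

theorem Distributed.tendsto_multiscaleSeq_map (h : Distributed c φ) (q : ℕ → ℕ) :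
    Tendsto (fun n => (multiscaleSeq q n).map (f := c) .of_discrete) atTop
      (𝓝 ⟨densityMeasure φ, h.isProbabilityMeasure_densityMeasure⟩) := by
  refine ProbabilityMeasure.tendsto_iff_forall_lintegral_tendsto.2 fun f => ?_
  refine ((tendsto_lintegral_multiscale (h.tendsto_lintegral_uniformOn f.continuous) q).comp
    (tendsto_add_atTop_nat 1)).congr fun n => ?_
  rw [ProbabilityMeasure.toMeasure_map,
    lintegral_map f.continuous.measurable.coe_nnreal_ennreal .of_discrete]
  rfl

theorem eventually_ae_multiscaleSeq (q : ℕ → ℕ) {p : ℕ → Prop} (h : ∀ᶠ k in atTop, p k) :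
    ∀ᶠ n in atTop, ∀ᵐ i ∂(multiscaleSeq q n : Measure ℕ), p i := by
  filter_upwards [eventually_forall_ge_atTop.2 h] with n hn
  exact (ae_mem_multiBlock_multiscale _ _).mono fun i hi =>
    hn i ((Nat.le_succ n).trans (le_of_mem_multiBlock hi))

theorem mutualEnergy_nearKernel_uniformOn_le {s t : Finset ℕ} (hc : ∀ k, c k ∈ Icc (0 : ℝ) 1)
    (hne : ∀ i ∈ s, ∀ j ∈ t, i ≠ j → c i ≠ c j) (hcard : 0 < (s ×ˢ t).card) {δ : ℝ} {ε : ℝ≥0}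
    (h : (∑ p ∈ (s ×ˢ t).filter (fun p => p.1 ≠ p.2 ∧ |c p.1 - c p.2| < δ),
      -Real.log |c p.1 - c p.2|) / ((s ×ˢ t).card : ℝ) ≤ ε) :
    mutualEnergy (nearKernel c δ) (uniformOn (s : Set ℕ)) (uniformOn (t : Set ℕ)) ≤ ε := by
  have hnonneg : ∀ p ∈ (s ×ˢ t).filter (fun p => p.1 ≠ p.2 ∧ |c p.1 - c p.2| < δ),
      0 ≤ -Real.log |c p.1 - c p.2| := fun p _ => neg_nonneg.2 <|
    Real.log_nonpos (abs_nonneg _) (by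
      simpa using abs_sub_le_of_le_of_le (hc p.1).1 (hc p.1).2 (hc p.2).1 (hc p.2).2)
  refine le_trans (le_of_eq ?_) (ENNReal.ofReal_le_coe.2 h)
  rw [mutualEnergy_uniformOn, ENNReal.ofReal_div_of_pos (by exact_mod_cast hcard),
    ENNReal.ofReal_natCast, ENNReal.ofReal_sum_of_nonneg hnonneg, Finset.sum_filter]
  congr 1
  refine Finset.sum_congr rfl fun p hp => ?_
  obtain ⟨hps, hpt⟩ := Finset.mem_product.1 hp
  rw [nearKernel, indicator_apply]
  simp only [mem_ofPred_eq, Real.dist_eq]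
  refine if_ctx_congr Iff.rfl (fun hpδ => ?_) fun _ => rfl
  rw [posLogKernel_of_dist_pos (dist_pos.2 (hne _ hps _ hpt hpδ.1)), Real.dist_eq]

theorem LogAverageSpacing.eventually_mutualEnergy_nearKernel_le (h : LogAverageSpacing c q)
    (hc : ∀ k, c k ∈ Icc (0 : ℝ) 1) {ε : ℝ≥0} (hε : 0 < ε) :
    ∃ δ : ℝ, 0 < δ ∧ ∀ᶠ n in atTop,
      mutualEnergy (nearKernel c δ) (multiscaleSeq q n : Measure ℕ) (multiscaleSeq q n) ≤ ε := by
  obtain ⟨δ, hδ, hev⟩ := h ε hε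
  refine ⟨δ, hδ, ?_⟩
  filter_upwards [(tendsto_add_atTop_nat 1).eventually hev] with n hn
  refine (mutualEnergy_multiscale_le (L := fun _ _ => ε) fun s hs t ht => ?_).trans_eq
    (by rw [mutualEnergy_kernel_const, measure_univ, mul_one, mul_one])
  refine mutualEnergy_nearKernel_uniformOn_le hc (hn s hs t ht).1 ?_ (hn s hs t ht).2.le
  rw [Finset.card_product, card_block, card_block]
  positivity

theorem GapControl.tendsto_length (h : GapControl c l q) (hc : ∀ k, c k ∈ Icc (0 : ℝ) 1)
    (hl : ∀ k, 0 < l k) : Tendsto l atTop (𝓝 0) := by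
  refine tendsto_order.2 ⟨fun b hb => Eventually.of_forall fun k => hb.trans (hl k), fun b hb => ?_⟩
  filter_upwards [h (b / 2) (half_pos hb), eventually_ge_atTop 2] with n hn hn2
  have hmem : ∀ i ∈ block n, i ∈ multiBlock n (q n) := fun i hi =>
    Finset.mem_biUnion.2 ⟨0, by simp, by simpa using hi⟩
  obtain ⟨hne, hlt⟩ := hn n (hmem _ (by simp [block]; omega)) (n + 1)
    (hmem _ (by simp [block]; omega)) (by simp)
  have hdist : |c n - c (n + 1)| ≤ 1 := by
    simpa using abs_sub_le_of_le_of_le (hc n).1 (hc n).2 (hc (n + 1)).1 (hc (n + 1)).2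
  rw [div_lt_iff₀ (by have := abs_pos.2 (sub_ne_zero.2 hne); positivity)] at hlt
  nlinarith [hl (n + 1)]

theorem GapControl.eventually_separated (h : GapControl c l q) {θ : ℝ} (hθ : 0 < θ) :
    ∀ᶠ n in atTop, ∀ᵐ j ∂(multiscaleSeq q n : Measure ℕ), ∀ᵐ i ∂(multiscaleSeq q n : Measure ℕ),
      i ≠ j → l i / 4 + l j / 4 ≤ θ * dist (c i) (c j) := by
  filter_upwards [(tendsto_add_atTop_nat 1).eventually (h (2 * θ) (by positivity))] with n hn
  filter_upwards [ae_mem_multiBlock_multiscale (n + 1) (q (n + 1))] with j hj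
  filter_upwards [ae_mem_multiBlock_multiscale (n + 1) (q (n + 1))] with i hi hij
  obtain ⟨hne, hlt⟩ := hn i hi j hj hij
  rw [div_lt_iff₀ (by have := abs_pos.2 (sub_ne_zero.2 hne); positivity)] at hlt
  rw [Real.dist_eq]
  linarith

theorem exists_eventually_ofReal_neg_log_le {r : ℕ → ℝ}
    (hlog : (fun k => Real.log (r k)) =O[atTop] fun k => (k : ℝ)) :
    ∃ C : ℝ≥0, ∀ᶠ k : ℕ in atTop, ENNReal.ofReal (-Real.log (r k)) + 2 ≤ C * k := by
  obtain ⟨C, hC⟩ := hlog.bound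
  refine ⟨C.toNNReal + 2, ?_⟩
  filter_upwards [hC, eventually_ge_atTop 1] with k hk hk1
  rw [ENNReal.coe_add, add_mul]
  refine add_le_add ?_ (le_mul_of_one_le_right' (by exact_mod_cast hk1))
  rw [← ENNReal.ofReal_natCast, ENNReal.ofNNReal_toNNReal,
    ← ENNReal.ofReal_mul' k.cast_nonneg]
  refine ENNReal.ofReal_le_ofReal ((neg_le_abs _).trans ?_)
  simpa using hk

theorem tendsto_lintegral_mul_multiscaleSeq {D : ℕ → ℝ≥0∞} {C : ℝ≥0}
    (hD : ∀ᶠ k : ℕ in atTop, D k ≤ C * k) (hq : Tendsto q atTop atTop) :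
    Tendsto (fun n => ∫⁻ i, D i * (multiscaleSeq q n : Measure ℕ) {i} ∂(multiscaleSeq q n)) atTop
      (𝓝 0) := by
  have hlim : Tendsto (fun n => 2 * (C : ℝ≥0∞) / (q (n + 1) + 1 : ℕ)) atTop (𝓝 0) := by
    rw [← ENNReal.div_top (a := 2 * (C : ℝ≥0∞))]
    exact (ENNReal.Tendsto.const_div ENNReal.tendsto_nat_nhds_top (Or.inr (by finiteness))).comp <|
      (tendsto_add_atTop_nat 1).comp (hq.comp (tendsto_add_atTop_nat 1))
  refine tendsto_of_tendsto_of_tendsto_of_le_of_le' tendsto_const_nhds hlim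
    (Eventually.of_forall fun _ => zero_le) ?_
  filter_upwards [eventually_forall_ge_atTop.2 hD] with n hn
  rw [← mutualEnergy_diagKernel, Nat.cast_add_one]
  exact mutualEnergy_diagKernel_multiscale_le fun i hi => hn i ((Nat.le_succ n).trans hi)

theorem wellSpaced_multiscaleSeq (hc : ∀ k, c k ∈ Icc (0 : ℝ) 1) (hl : ∀ k, 0 < l k)
    (hlog : (fun k => Real.log (l k)) =O[atTop] fun k => (k : ℝ)) (hq : Tendsto q atTop atTop)
    (hspacing : LogAverageSpacing c q) (hgap : GapControl c l q) :
    WellSpaced (multiscaleSeq q) atTop c fun k => l k / 4 where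
  near _ hε := hspacing.eventually_mutualEnergy_nearKernel_le hc hε
  separated _ hθ := hgap.eventually_separated hθ
  diag := by
    have hlog2 : (fun k => Real.log (2 * (l k / 4))) =O[atTop] fun k => (k : ℝ) := by
      have hconst : (fun _ : ℕ => Real.log (1 / 2)) =O[atTop] fun k => (k : ℝ) :=
        (Asymptotics.isLittleO_const_left.2
          (Or.inr (tendsto_norm_atTop_atTop.comp tendsto_natCast_atTop_atTop))).isBigO
      refine (hconst.add hlog).congr_left fun k => ?_
      rw [← Real.log_mul (by norm_num) (hl k).ne']
      ring_nf
    obtain ⟨C, hC⟩ := exists_eventually_ofReal_neg_log_le hlog2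
    exact tendsto_lintegral_mul_multiscaleSeq hC hq

end Centers

section LimsupSet

variable {c l : ℕ → ℝ} {φ : ℝ → ℝ} {q : ℕ → ℕ}

theorem Distributed.absolutelyContinuous_densityMeasure (h : Distributed c φ) {ν : Measure ℝ}
    (hν : ν ≪ volume) (hνI : ∀ᵐ x ∂ν, x ∈ Ioo (0 : ℝ) 1) : ν ≪ densityMeasure φ := by
  refine Measure.AbsolutelyContinuous.trans ?_ h.volume_absolutelyContinuous_densityMeasure
  rw [← Measure.restrict_eq_self_of_ae_mem (hνI.mono fun x hx => Ioo_subset_Icc_self hx)]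
  exact hν.restrict _

theorem isOpen_iUnion_interval (c l : ℕ → ℝ) (m : ℕ) :
    IsOpen (⋃ k : ℕ, ⋃ _ : m ≤ k, interval c l k) :=
  isOpen_iUnion fun _ => isOpen_iUnion fun _ => isOpen_Ioo

theorem closedBall_subset_interval {k : ℕ} (hl : 0 < l k) :
    Metric.closedBall (c k) (l k / 4) ⊆ interval c l k := by
  rw [interval, ← Real.ball_eq_Ioo]
  exact Metric.closedBall_subset_ball (by linarith)

theorem exists_ae_mem_inter_iUnion_interval
    (hc : ∀ k, c k ∈ Icc (0 : ℝ) 1) (hl : ∀ k, 0 < l k)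
    (hlog : (fun k => Real.log (l k)) =O[atTop] fun k => (k : ℝ)) (hφ : Distributed c φ)
    (hq : Tendsto q atTop atTop) (hspacing : LogAverageSpacing c q) (hgap : GapControl c l q)
    {ν : Measure ℝ} [IsProbabilityMeasure ν] (hν : ν ≪ volume)
    (hνI : ∀ᵐ x ∂ν, x ∈ Ioo (0 : ℝ) 1) (hE : mutualEnergy posLogKernel ν ν ≠ ∞)
    {U : Set ℝ} (hU : IsOpen U) (hνU : ∀ᵐ x ∂ν, x ∈ U) (m : ℕ) {ε : ℝ≥0∞} (hε : ε ≠ 0) :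
    ∃ (ν' : ProbabilityMeasure ℝ) (F : Set ℝ), (ν' : Measure ℝ) ≪ volume ∧ IsCompact F ∧
      F ⊆ U ∩ (⋃ k : ℕ, ⋃ _ : m ≤ k, interval c l k) ∧ (∀ᵐ x ∂(ν' : Measure ℝ), x ∈ F) ∧
      mutualEnergy (posLogKernel (X := ℝ)) ν' ν' ≤ mutualEnergy posLogKernel ν ν + ε := by
  have hr0 : Tendsto (fun k => l k / 4) atTop (𝓝 0) := by
    simpa using (hgap.tendsto_length hc hl).div_const 4
  refine (wellSpaced_multiscaleSeq hc hl hlog hq hspacing hgap).exists_mutualEnergy_le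
    (hφ.tendsto_multiscaleSeq_map q) (fun k => div_pos (hl k) four_pos)
    (Eventually.of_forall fun n => ⟨_, Finset.finite_toSet _, ae_mem_multiBlock_multiscale _ _⟩)
    (fun ρ hρ => eventually_ae_multiscaleSeq q (hr0.eventually_le_const hρ))
    (eventually_ae_multiscaleSeq q ((eventually_ge_atTop m).mono fun k hk => ?_))
    (hφ.absolutelyContinuous_densityMeasure hν hνI) hU hνU hE hε
  exact (closedBall_subset_interval (hl k)).trans
    (subset_biUnion_of_mem (u := fun k => interval c l k) hk)

theorem exists_ae_mem_iInter_iUnion_interval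
    (hc : ∀ k, c k ∈ Icc (0 : ℝ) 1) (hl : ∀ k, 0 < l k)
    (hlog : (fun k => Real.log (l k)) =O[atTop] fun k => (k : ℝ)) (hφ : Distributed c φ)
    (hq : Tendsto q atTop atTop) (hspacing : LogAverageSpacing c q) (hgap : GapControl c l q)
    {ν : Measure ℝ} [IsProbabilityMeasure ν] (hν : ∀ᵐ x ∂ν, x ∈ Icc (0 : ℝ) 1)
    (hE : mutualEnergy posLogKernel ν ν ≠ ∞) {ε : ℝ≥0} (hε : ε ≠ 0) :
    ∃ (μ : ProbabilityMeasure ℝ) (F : Set ℝ), IsCompact F ∧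
      F ⊆ (⋂ m : ℕ, ⋃ k : ℕ, ⋃ _ : m ≤ k, interval c l k) ∧ (∀ᵐ x ∂(μ : Measure ℝ), x ∈ F) ∧
      mutualEnergy (posLogKernel (X := ℝ)) μ μ ≤ mutualEnergy posLogKernel ν ν + ε := by
  have hε2 : ε / 2 ≠ 0 := (half_pos (pos_iff_ne_zero.2 hε)).ne'
  obtain ⟨ν₀, hν₀, hν₀I, hν₀E⟩ := exists_absolutelyContinuous_mutualEnergy_le ν hν hE hε2
  obtain ⟨μ, F, hF, hFS, hμF, hμE⟩ := exists_ae_mem_iInter_of_forall_exists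
    (P := fun η => (η : Measure ℝ) ≪ volume ∧ (∀ᵐ x ∂(η : Measure ℝ), x ∈ Ioo (0 : ℝ) 1) ∧
      mutualEnergy (posLogKernel (X := ℝ)) η η ≠ ∞)
    continuous_posLogKernel (isOpen_iUnion_interval c l)
    (fun η ⟨hη, hηI, hηE⟩ U hU hηU m e he => by
      obtain ⟨η', F, hη', hF, hFU, hη'F, hη'E⟩ :=
        exists_ae_mem_inter_iUnion_interval hc hl hlog hφ hq hspacing
          hgap hη hηI hηE (hU.inter isOpen_Ioo) (hηU.and hηI) m (ENNReal.coe_ne_zero.2 he)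
      exact ⟨η', F, ⟨hη', hη'F.mono fun x hx => (hFU hx).1.2,
        ne_top_of_le_ne_top (by finiteness) hη'E⟩, hF,
        hFU.trans (inter_subset_inter_left _ inter_subset_left), hη'F, hη'E⟩)
    ⟨hν₀, hν₀I, ne_top_of_le_ne_top (by finiteness) hν₀E⟩ (ENNReal.coe_ne_zero.2 hε2)
  refine ⟨μ, F, hF, hFS, hμF, hμE.trans ((add_le_add_left hν₀E _).trans_eq ?_)⟩
  rw [add_assoc, ← ENNReal.coe_add, add_halves]

end LimsupSet

section Capacity

theorem logKernel_ofReal (x y : ℝ) : logKernel x y = -ENNReal.log (edist x y) := by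
  rw [logKernel, Complex.isometry_ofReal.edist_eq]

theorem log_edist_le_zero {x y : ℝ} (hx : x ∈ Icc (0 : ℝ) 1) (hy : y ∈ Icc (0 : ℝ) 1) :
    ENNReal.log (edist x y) ≤ 0 := by
  rw [ENNReal.log_le_zero_iff, edist_dist, Real.dist_eq, ENNReal.ofReal_le_one]
  simpa using abs_sub_le_of_le_of_le hx.1 hx.2 hy.1 hy.2

theorem energy_map_ofReal {ν : Measure ℝ} (hν : ∀ᵐ x ∂ν, x ∈ Icc (0 : ℝ) 1) :
    energy (ν.map Complex.ofReal) = (mutualEnergy posLogKernel ν ν : EReal) := by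
  have hneg : ∫⁻ y, ∫⁻ x, (-logKernel (x : ℂ) y).toENNReal ∂ν ∂ν = 0 := by
    refine lintegral_eq_zero_of_ae_eq_zero (hν.mono fun y hy => ?_)
    refine lintegral_eq_zero_of_ae_eq_zero (hν.mono fun x hx => ?_)
    refine EReal.toENNReal_of_nonpos ?_
    rw [logKernel_ofReal, neg_neg]
    exact log_edist_le_zero hx hy
  have hemb := Complex.isometry_ofReal.isClosedEmbedding.measurableEmbedding
  rw [energy, interaction]
  simp only [hemb.lintegral_map, hneg]
  rw [EReal.coe_ennreal_zero, sub_zero]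
  simp only [logKernel_ofReal, mutualEnergy, posLogKernel]

theorem exists_map_ofReal_eq {μ : Measure ℂ} [IsProbabilityMeasure μ]
    (h : μ.support ⊆ unitInterval) :
    ∃ ν : Measure ℝ, IsProbabilityMeasure ν ∧ (∀ᵐ x ∂ν, x ∈ Icc (0 : ℝ) 1) ∧
      ν.map Complex.ofReal = μ := by
  have hμ : ∀ᵐ z ∂μ, z ∈ unitInterval := mem_of_superset Measure.support_mem_ae h
  refine ⟨μ.map Complex.re, Measure.isProbabilityMeasure_map (by fun_prop), ?_, ?_⟩
  · refine (ae_map_iff (by fun_prop) measurableSet_Icc).2 (hμ.mono ?_)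
    rintro _ ⟨x, hx, rfl⟩
    exact hx
  · rw [Measure.map_map (by fun_prop) (by fun_prop)]
    refine (Measure.map_congr (hμ.mono ?_)).trans Measure.map_id
    rintro _ ⟨x, -, rfl⟩
    simp

theorem support_map_subset_image {X Y : Type*} [TopologicalSpace X] [MeasurableSpace X]
    [OpensMeasurableSpace X] [TopologicalSpace Y] [T2Space Y] [MeasurableSpace Y] [BorelSpace Y]
    {ν : Measure X} {F : Set X} (hF : IsCompact F) (h : ∀ᵐ x ∂ν, x ∈ F) {f : X → Y}
    (hf : Continuous f) : (ν.map f).support ⊆ f '' F := by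
  have hclosed : IsClosed (f '' F) := (hF.image hf).isClosed
  refine Measure.support_subset_of_isClosed hclosed ?_
  exact (ae_map_iff hf.aemeasurable hclosed.measurableSet).2 (h.mono fun x => mem_image_of_mem f)

/-- The least energy `inf I(μ)` of the probability measures with compact support in `E`, for which
`capacity E = exp (-minEnergy E)`. -/
def minEnergy (E : Set ℂ) : EReal :=
  ⨅ (μ : Measure ℂ) (_ : IsProbabilityMeasure μ) (_ : IsCompact μ.support) (_ : μ.support ⊆ E),
    energy μ

theorem capacity_eq_exp_neg_minEnergy (E : Set ℂ) : capacity E = EReal.exp (-minEnergy E) := rfl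

theorem minEnergy_anti {E E' : Set ℂ} (h : E ⊆ E') : minEnergy E' ≤ minEnergy E :=
  iInf_mono fun _ => iInf_mono fun _ => iInf_mono fun _ =>
    iInf_mono' fun hE => ⟨hE.trans h, le_rfl⟩

theorem minEnergy_image_ofReal_le {ν : Measure ℝ} [IsProbabilityMeasure ν] {E F : Set ℝ}
    (hE : E ⊆ Icc 0 1) (hF : IsCompact F) (hFE : F ⊆ E) (hν : ∀ᵐ x ∂ν, x ∈ F) :
    minEnergy ((fun x : ℝ => (x : ℂ)) '' E) ≤ (mutualEnergy posLogKernel ν ν : EReal) := by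
  have hsupp := support_map_subset_image hF hν Complex.continuous_ofReal
  rw [← energy_map_ofReal (hν.mono fun x hx => hE (hFE hx))]
  exact iInf_le_of_le _ <| iInf_le_of_le (Measure.isProbabilityMeasure_map (by fun_prop)) <|
    iInf_le_of_le ((hF.image Complex.continuous_ofReal).of_isClosed_subset
      Measure.isClosed_support hsupp) <| iInf_le _ (hsupp.trans (image_mono hFE))

theorem capacity_unitInterval_pos : 0 < capacity unitInterval := by
  have := isProbabilityMeasure_uniformBall (a := 1 / 2) one_half_pos
  have hball : Metric.closedBall (1 / 2 : ℝ) (1 / 2) ⊆ Icc 0 1 := by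
    rw [Real.closedBall_eq_Icc]
    norm_num
  have hfinite := ne_top_of_le_ne_top (by finiteness)
    (mutualEnergy_uniformBall_le one_half_pos (1 / 2) (uniformBall (1 / 2) (1 / 2)))
  have hle := minEnergy_image_ofReal_le Subset.rfl (isCompact_closedBall (1 / 2 : ℝ) (1 / 2)) hball
    (ae_mem_closedBall_uniformBall _ _)
  rw [capacity_eq_exp_neg_minEnergy, EReal.zero_lt_exp_iff, bot_lt_iff_ne_bot, Ne,
    EReal.neg_eq_bot_iff]
  exact (hle.trans_lt (lt_top_iff_ne_top.2 (by simpa using hfinite))).ne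

theorem limsup_interval_subset_Icc {c l : ℕ → ℝ} (hc : ∀ k, c k ∈ Icc (0 : ℝ) 1)
    (hl : Tendsto l atTop (𝓝 0)) :
    ⋂ m : ℕ, ⋃ k : ℕ, ⋃ _ : m ≤ k, interval c l k ⊆ Icc 0 1 := by
  intro x hx
  have hfreq : ∃ᶠ k in atTop, x ∈ interval c l k := frequently_atTop.2 fun m => by
    simpa using mem_iInter.1 hx m
  have hhalf : Tendsto (fun k => l k / 2) atTop (𝓝 0) := by simpa using hl.div_const 2
  constructor
  · refine le_of_tendsto_of_frequently (x := atTop) (f := fun k => -(l k / 2))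
      (by simpa using hhalf.neg) (hfreq.mono fun k hk => ?_)
    linarith [(hc k).1, hk.1]
  · refine ge_of_tendsto_of_frequently (x := atTop) (f := fun k => 1 + l k / 2)
      (by simpa using hhalf.const_add 1) (hfreq.mono fun k hk => ?_)
    linarith [(hc k).2, hk.2]

theorem minEnergy_limsupSet_le {c l : ℕ → ℝ} {φ : ℝ → ℝ} {q : ℕ → ℕ}
    (hc : ∀ k, c k ∈ Icc (0 : ℝ) 1) (hl : ∀ k, 0 < l k)
    (hlog : (fun k => Real.log (l k)) =O[atTop] fun k => (k : ℝ)) (hφ : Distributed c φ)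
    (hq : Tendsto q atTop atTop) (hspacing : LogAverageSpacing c q) (hgap : GapControl c l q) :
    minEnergy (limsupSet c l) ≤ minEnergy unitInterval := by
  have hsub := limsup_interval_subset_Icc hc (hgap.tendsto_length hc hl)
  refine le_iInf fun μ => le_iInf fun _ => le_iInf fun _ => le_iInf fun hμ => ?_
  obtain ⟨ν, _, hν, rfl⟩ := exists_map_ofReal_eq hμ
  rw [energy_map_ofReal hν]
  obtain hE | hE := eq_or_ne (mutualEnergy posLogKernel ν ν) ∞
  · simp [hE]
  refine ((le_max_right 0 _).trans_eq EReal.coe_toENNReal_eq_max.symm).trans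
    (EReal.coe_ennreal_le_coe_ennreal_iff.2 (ENNReal.le_of_forall_pos_le_add fun ε hε _ => ?_))
  obtain ⟨η, F, hF, hFS, hηF, hηE⟩ := exists_ae_mem_iInter_iUnion_interval hc hl hlog hφ hq
    hspacing hgap hν hE hε.ne'
  exact (EReal.toENNReal_le_toENNReal (minEnergy_image_ofReal_le hsub hF hFS hηF)).trans
    (by simpa using hηE)

end Capacity

end LogCap

end

theorem mainTheorem1_general
    (c : ℕ → ℝ) (hc : ∀ k, c k ∈ Set.Icc (0 : ℝ) 1)
    (l : ℕ → ℝ) (hl : ∀ k, 0 < l k)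
    (hlog : (fun k => Real.log (l k)) =O[Filter.atTop] fun k => (k : ℝ))
    (φ : ℝ → ℝ) (hA1 : LogCap.Distributed c φ)
    (q : ℕ → ℕ) (hq : Filter.Tendsto q Filter.atTop Filter.atTop)
    (hA2 : LogCap.LogAverageSpacing c q)
    (hA3 : LogCap.GapControl c l q) :
    LogCap.HasFullCapacityOn (LogCap.limsupSet c l) LogCap.unitInterval ∧
      0 < LogCap.capacity LogCap.unitInterval := by
  have hsub : LogCap.limsupSet c l ⊆ LogCap.unitInterval :=
    Set.image_mono (LogCap.limsup_interval_subset_Icc hc (hA3.tendsto_length hc hl))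
  have hle := LogCap.minEnergy_limsupSet_le hc hl hlog hA1 hq hA2 hA3
  refine ⟨⟨hsub, ?_⟩, LogCap.capacity_unitInterval_pos⟩
  rw [LogCap.capacity_eq_exp_neg_minEnergy, LogCap.capacity_eq_exp_neg_minEnergy,
    hle.antisymm (LogCap.minEnergy_anti hsub)]

theorem mainTheorem1 (lam : ℝ) (hlam : 0 < lam)
    (c : ℕ → ℝ) (hc : ∀ k, c k ∈ Set.Ioo (0 : ℝ) 1)
    (l : ℕ → ℝ) (hl : ∀ k : ℕ, l k = Real.exp (-lam * (k : ℝ)))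
    (φ : ℝ → ℝ) (hA1 : LogCap.Distributed c φ)
    (q : ℕ → ℕ) (hq : Filter.Tendsto q Filter.atTop Filter.atTop)
    (hA2 : LogCap.LogAverageSpacing c q)
    (hA3 : LogCap.GapControl c l q) :
    LogCap.HasFullCapacityOn (LogCap.limsupSet c l) LogCap.unitInterval ∧
      0 < LogCap.capacity LogCap.unitInterval :=
  mainTheorem1_general c (fun k => Set.Ioo_subset_Icc_self (hc k)) l
    (fun k => hl k ▸ Real.exp_pos _)
    (by simpa [hl] using (Asymptotics.isBigO_refl _ _).const_mul_left (-lam)) φ hA1 q hq hA2 hA3
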